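/- Let $A$ be a Weil algebra, i.e. a finite-dimensional local commutative $\mathbb R$-algebra with unit, with maximal ideal $\mathfrak m_A$; let $I\subsetneq A$ be an ideal, $\mathrm{Ann}(I)=\{a\in A: ab=0\ \text{for all } b\in I\}$, and let $\phi\colon A\to B=A/I$ be the projection. Let $M$ be a smooth manifold (Hausdorff, second countable, of dimension $n$). Let $M^A$ be the space of $A$-points of $M$, i.e. of $\mathbb R$-algebra morphisms $C^\infty(M)\to A$, with the smooth structure generated by the functions $p\mapsto \ell(p(f))$, where $f\in C^\infty(M)$ and $\ell$ is a linear form on $A$. Let $\check M^A\subseteq M^A$ be the open subspace of regular (that is, surjective) $A$-points, and assume that it is not empty. Put $\hat\phi\colon M^A\to M^B$, $\hat\phi(p)=\phi\circ p$, and let $\check\phi\colon\check M^A\to\check M^B$ be its restriction. For $p\in M^A$ the vertical tangent space of $\hat\phi$ at $p$ is the space of $\mathbb R$-linear maps $D\colon C^\infty(M)\to I$ with $D(fg)=p(f)D(g)+p(g)D(f)$. Then the addition law $(p,D)\mapsto p+D$ makes $\check\phi\colon\check M^A\to\check M^B$ a smooth affine bundle if and only if $I\subseteq\mathfrak m_A^2\cap\mathrm{Ann}(I)$.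 Here "the addition law makes $\check\phi$ a smooth affine bundle" means: $\check\phi$ is onto; the vertical tangent space at $p$ depends only on $\check\phi(p)$; the sum $p+D$ of $p\in\check M^A$ and a vertical $D$ at $p$ is again in $\check M^A$, in the fibre of $p$; any two points of a fibre of $\check\phi$ differ by a vertical $D$; and locally on $\check M^B$ there are smooth trivializations of $\check\phi$ and of the vector bundle of vertical tangent spaces over $\check M^B$, the first fibrewise affine with linear part the second, the second fibrewise linear. Moreover, $I\subseteq\mathfrak m_A^2$ if and only if every $p\in M^A$ for which $\hat\phi(p)$ is a regular $B$-point is itself regular, i.e. $\hat\phi^{-1}(\check M^B)\subseteq\check M^A$. -/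

import Mathlib

open scoped Manifold ContDiff Topology

noncomputable section

/-! ### Smooth structures generated by real functions

The spaces below are sets of algebra morphisms, and their smooth structure is the one generated by
given real functions: the topology is the initial one, and a real function is smooth when it is
locally a `C^∞` function of finitely many of the given ones. On a manifold in which the given
functions are smooth and contain a coordinate system around every point, these are exactly the
topology and the smooth functions of the manifold. -/

/-- A set with a family of real functions that generates its smooth structure. -/
class SmoothSpace (X : Type*) where
  /-- the generating functions -/
  coord : Set (X → ℝ)

namespace SmoothSpace

/-- The topology: the coarsest one for which the generating functions are continuous. -/
abbrev topology (X : Type*) [SmoothSpace X] : TopologicalSpace X :=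
  ⨅ c ∈ coord (X := X), TopologicalSpace.induced c inferInstance

/-- A real function is smooth if it is locally a `C^∞` function of finitely many generators. -/
def IsSmoothFun {X : Type*} [SmoothSpace X] (h : X → ℝ) : Prop :=
  ∀ x : X, ∃ U : Set X, IsOpen[topology X] U ∧ x ∈ U ∧
    ∃ (m : ℕ) (c : Fin m → X → ℝ) (G : (Fin m → ℝ) → ℝ),
      (∀ j, c j ∈ coord (X := X)) ∧ ContDiff ℝ ∞ G ∧ ∀ y ∈ U, h y = G (fun j => c j y)

/-- A map is smooth if it pulls the generating functions back to smooth functions. -/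
def IsSmoothMap {X Y : Type*} [SmoothSpace X] [SmoothSpace Y] (F : X → Y) : Prop :=
  ∀ c ∈ coord (X := Y), IsSmoothFun (fun x => c (F x))

/-- The numerical space `ℝ^k` with its usual coordinates. -/
instance (k : ℕ) : SmoothSpace (Fin k → ℝ) where
  coord := {c | ∃ j : Fin k, c = fun v => v j}

instance {X Y : Type*} [SmoothSpace X] [SmoothSpace Y] : SmoothSpace (X × Y) where
  coord := {c | (∃ a ∈ coord (X := X), c = fun z => a z.1) ∨
    (∃ a ∈ coord (X := Y), c = fun z => a z.2)}

/-- Subspaces; this is used for open subsets only. -/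
instance {X : Type*} [SmoothSpace X] (P : X → Prop) : SmoothSpace {x : X // P x} where
  coord := {c | ∃ a ∈ coord (X := X), c = fun z => a z.1}

end SmoothSpace

/-! ### Near-points -/

section NearPoints

variable (n : ℕ) (M : Type*) [TopologicalSpace M] [ChartedSpace (EuclideanSpace ℝ (Fin n)) M]

/-- The algebra `C^∞(M)` of smooth real functions on the manifold `M`. -/
abbrev SmoothFun : Type _ := C^∞⟮𝓡 n, M; 𝓘(ℝ, ℝ), ℝ⟯

/-- The space `M^A` of `A`-points of `M`: the algebra morphisms `C^∞(M) → A`. -/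
def NearPoint (A : Type*) [CommRing A] [Algebra ℝ A] : Type _ := SmoothFun n M →ₐ[ℝ] A

/-- The components `p ↦ ℓ (p f)`, with `ℓ` a linear form on `A`, generate the smooth structure of
`M^A`. -/
instance (A : Type*) [CommRing A] [Algebra ℝ A] : SmoothSpace (NearPoint n M A) where
  coord := {c | ∃ (f : SmoothFun n M) (ℓ : Module.Dual ℝ A),
    c = fun p : SmoothFun n M →ₐ[ℝ] A => ℓ (p f)}

/-- The value of a near-point on a smooth function. -/
def NearPoint.val {n : ℕ} {M : Type*} [TopologicalSpace M]
    [ChartedSpace (EuclideanSpace ℝ (Fin n)) M] {A : Type*} [CommRing A] [Algebra ℝ A]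
    (p : NearPoint n M A) : SmoothFun n M →ₐ[ℝ] A := p

/-- An `A`-point is regular if it is surjective. -/
def NearPoint.IsRegular {n : ℕ} {M : Type*} [TopologicalSpace M]
    [ChartedSpace (EuclideanSpace ℝ (Fin n)) M] {A : Type*} [CommRing A] [Algebra ℝ A]
    (p : NearPoint n M A) : Prop := Function.Surjective p.val

/-- The space of regular `A`-points, an open subspace of `M^A`. -/
abbrev RegPoint (A : Type*) [CommRing A] [Algebra ℝ A] : Type _ :=
  {p : NearPoint n M A // p.IsRegular}

variable {n M} {A : Type*} [CommRing A] [Algebra ℝ A] (I : Ideal A)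

/-- The natural transformation `M^A → M^(A/I)`: composition with the projection `A → A/I`. -/
def natTrans (p : NearPoint n M A) : NearPoint n M (A ⧸ I) :=
  (Ideal.Quotient.mkₐ ℝ I).comp p.val

/-- Its restriction to regular points. -/
def regTrans (p : RegPoint n M A) : RegPoint n M (A ⧸ I) :=
  ⟨natTrans I p.1, (Ideal.Quotient.mkₐ_surjective ℝ I).comp p.2⟩

/-- The vertical tangent space of `M^A → M^(A/I)` at `p`: tangent vectors at `p` are the derivations
`D : C^∞(M) → A` over `p`, and the vertical ones, which the projection to `A/I` sends to zero, are
those with values in `I`. -/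
def vertDer (p : NearPoint n M A) : Submodule ℝ (SmoothFun n M →ₗ[ℝ] A) where
  carrier := {D | (∀ f g, D (f * g) = p.val f * D g + p.val g * D f) ∧ ∀ f, D f ∈ I}
  add_mem' := by
    rintro D E ⟨hD, hD'⟩ ⟨hE, hE'⟩
    refine ⟨fun f g => ?_, fun f => I.add_mem (hD' f) (hE' f)⟩
    simp only [LinearMap.add_apply, hD, hE]
    ring
  zero_mem' := ⟨fun f g => by simp, fun f => by simp⟩
  smul_mem' := by
    rintro r D ⟨hD, hD'⟩
    refine ⟨fun f g => ?_, fun f => ?_⟩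
    · simp only [LinearMap.smul_apply, hD, smul_add, mul_smul_comm]
    · rw [LinearMap.smul_apply, Algebra.smul_def]
      exact I.mul_mem_left _ (hD' f)

/-- The fibre over `b` of the model vector bundle. It is used where the vertical tangent space is
the same at all the (existing) regular points over `b`, and then it is this common space. -/
def modelFibre (b : RegPoint n M (A ⧸ I)) : Submodule ℝ (SmoothFun n M →ₗ[ℝ] A) :=
  ⨅ (p : RegPoint n M A) (_ : regTrans I p = b), vertDer I p.1

variable (n M)

/-- The total space of the model vector bundle. -/
structure ModelBundle where
  /-- the base point -/
  base : RegPoint n M (A ⧸ I)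
  /-- the derivation -/
  vec : modelFibre I base

/-- Its smooth structure is generated by the components of the base point `b` and by those of the
derivation `D`. -/
instance : SmoothSpace (ModelBundle n M I) where
  coord := {c | (∃ a ∈ SmoothSpace.coord (X := RegPoint n M (A ⧸ I)), c = fun t => a t.base) ∨
    (∃ (f : SmoothFun n M) (ℓ : Module.Dual ℝ A), c = fun t => ℓ (t.vec.1 f))}

/-- The addition law `(p, D) ↦ p + D` of morphisms and derivations makes the projection of the
regular `A`-points onto the regular `A/I`-points a smooth affine bundle, modelled on the vector
bundle of vertical derivations. -/
structure IsCanonicalAffineBundle : Prop where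
  /-- The projection is onto: no fibre is empty. -/
  surjective : Function.Surjective (regTrans I : RegPoint n M A → RegPoint n M (A ⧸ I))
  /-- The vertical tangent space depends on the base point only. -/
  vertDer_eq : ∀ p q : RegPoint n M A, regTrans I p = regTrans I q →
    vertDer I p.1 = vertDer I q.1
  /-- The sum of a regular point and a vertical vector is a regular point of the same fibre. -/
  add_mem : ∀ (p : RegPoint n M A), ∀ D ∈ vertDer I p.1, ∃ q : RegPoint n M A,
    regTrans I q = regTrans I p ∧ ∀ f, q.1.val f = p.1.val f + D f
  /-- Any two points of a fibre differ by a vertical vector, so that the vertical vectors act simply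
  transitively on the fibre. -/
  sub_mem : ∀ p q : RegPoint n M A, regTrans I q = regTrans I p →
    ∃ D ∈ vertDer I p.1, ∀ f, q.1.val f = p.1.val f + D f
  /-- Around every base point there are smooth trivializations `Φ` of the bundle and `L` of the
  model vector bundle such that `L` is linear on the fibres and `Φ` is affine on the fibres, with
  linear part `L`. -/
  locally_trivial : ∀ b : RegPoint n M (A ⧸ I), ∃ U : Set (RegPoint n M (A ⧸ I)),
    IsOpen[SmoothSpace.topology (RegPoint n M (A ⧸ I))] U ∧ b ∈ U ∧
    ∃ (k : ℕ)
      (Φ : U × (Fin k → ℝ) ≃ {p : RegPoint n M A // regTrans I p ∈ U})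
      (L : ∀ u : U, (Fin k → ℝ) ≃ₗ[ℝ] modelFibre I u.1),
      (∀ x, regTrans I (Φ x).1 = x.1.1) ∧
      SmoothSpace.IsSmoothMap Φ ∧ SmoothSpace.IsSmoothMap Φ.symm ∧
      SmoothSpace.IsSmoothMap
        (fun x : U × (Fin k → ℝ) => (⟨x.1.1, L x.1 x.2⟩ : ModelBundle n M I)) ∧
      SmoothSpace.IsSmoothMap
        (fun t : {t : ModelBundle n M I // t.base ∈ U} => (L ⟨t.1.base, t.2⟩).symm t.1.vec) ∧
      ∀ (u : U) (v w : Fin k → ℝ) (f : SmoothFun n M),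
        (Φ (u, v + w)).1.1.val f = (Φ (u, v)).1.1.val f + (L u w).1 f

end NearPoints

end

/-! Write `m = ker ρ` for the nilpotent maximal ideal. The residue `ρ ∘ p` of an `A`-point is
evaluation at a point of `M` (`exists_eq_evalPoint`), around which there is a frame of coordinates
`x i` and vector fields `X i`. Hadamard's lemma and nilpotency show that `p` is determined by its
residue and the `p (x i)` (`algHom_ext`), and a derivation over `p` by its components on the `x i`.
Conversely, Taylor expansion realises all increments in `m` (`taylorHom`), and `frameDer` realises
all components. Thus everything is linear algebra in these coordinates.

Sufficiency: `I ⊆ Ann(I)` says that products of two elements of `I` vanish. So `p + D` is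
multiplicative, differences within a fibre are derivations, and vertical spaces depend only on the
base point. `I ⊆ m²` makes anything onto modulo `I` onto (`subalgebra_eq_top`). A linear section of
`A → A/I` and Taylor expansion give a smooth local section, from which vertical components
trivialize the bundle.

Necessity: the square of a coordinate, evaluated by `p + D`, forces `a² = 0` on `I`, and
polarization gives `ab = 0`. If `v ∈ I` is not in `m²`, take a linear form `Λ` killing the constants
and `m²` with `Λ v = 1`. Moving each `p (x i)` by a multiple of `v` into `ker Λ` gives a point equal
to `p` modulo `I` whose image lies in `ker Λ`, so it is not regular. The same point proves the last
equivalence. -/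

/-- Functions `x i` and derivations `X i` of an algebra `S`, dual to each other and satisfying
Hadamard's lemma at the real points of `S` at which `χ` does not vanish. -/
structure LocalFrame (S : Type*) [CommRing S] [Algebra ℝ S] (n : ℕ) where
  /-- a function that does not vanish at the points of the domain of the frame -/
  χ : S
  /-- the coordinate functions -/
  x : Fin n → S
  /-- the coordinate vector fields -/
  X : Fin n → Derivation ℝ S S
  frame : ∀ i j, χ * (X i (x j) - if i = j then 1 else 0) = 0
  hadamard : ∀ ε : S →ₐ[ℝ] ℝ, ε χ ≠ 0 → ∀ f, ∃ (g : Fin n → S) (h : S), ε h ≠ 0 ∧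
    h * (f - algebraMap ℝ S (ε f) - ∑ i, (x i - algebraMap ℝ S (ε (x i))) * g i) = 0

/-! ### Morphisms and derivations into an algebra with nilpotent `ker ρ` -/

namespace WeilAlgebra

variable {A : Type*} [CommRing A] [Algebra ℝ A] {ρ : A →ₐ[ℝ] ℝ} {N : ℕ}

theorem sub_algebraMap_mem_ker (ρ : A →ₐ[ℝ] ℝ) (a : A) :
    a - algebraMap ℝ A (ρ a) ∈ RingHom.ker ρ := by
  simp [RingHom.mem_ker]

theorem isUnit_of_ne_zero (hN : RingHom.ker ρ ^ N = ⊥) {a : A} (ha : ρ a ≠ 0) : IsUnit a := by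
  have h1 : IsNilpotent (a - algebraMap ℝ A (ρ a)) := by
    refine ⟨N, ?_⟩
    have := Ideal.pow_mem_pow (sub_algebraMap_mem_ker ρ a) N
    rwa [hN, Ideal.mem_bot] at this
  have h2 : IsUnit (algebraMap ℝ A (ρ a)) := (isUnit_iff_ne_zero.2 ha).map (algebraMap ℝ A)
  have := h1.isUnit_add_left_of_commute h2 (Commute.all _ _)
  simpa using this

/-- A subalgebra that contains `A` modulo the square of the nilpotent ideal `ker ρ` is `A`. -/
theorem subalgebra_eq_top (hN : RingHom.ker ρ ^ N = ⊥) (R : Subalgebra ℝ A)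
    (hR : ∀ a, ∃ r ∈ R, a - r ∈ RingHom.ker ρ ^ 2) : R = ⊤ := by
  set m := RingHom.ker ρ
  -- Products of elements of `R` that represent `m` modulo `m ^ 2` represent `m ^ (k + 1)` modulo `m
  -- ^ (k + 2)`; successive corrections then reach `m ^ N = 0`.
  have h1 : ∀ k : ℕ, ∀ a ∈ m ^ (k + 1), ∃ r ∈ R, r ∈ m ^ (k + 1) ∧ a - r ∈ m ^ (k + 2) := by
    have h0 : ∀ a ∈ m, ∃ r ∈ R, r ∈ m ∧ a - r ∈ m ^ 2 := by
      intro a ha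
      obtain ⟨r, hr, hr'⟩ := hR a
      refine ⟨r, hr, ?_, hr'⟩
      have := m.sub_mem ha (Ideal.pow_le_self two_ne_zero hr')
      simpa using this
    intro k
    induction k with
    | zero => simpa using h0
    | succ k ih =>
      intro a ha
      rw [pow_succ] at ha
      refine Submodule.mul_induction_on ha ?_ ?_
      · intro b hb c hc
        obtain ⟨r, hr, hr1, hr2⟩ := ih b hb
        obtain ⟨s, hs, hs1, hs2⟩ := h0 c hc
        refine ⟨r * s, R.mul_mem hr hs, ?_, ?_⟩
        · rw [pow_succ]; exact Ideal.mul_mem_mul hr1 hs1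
        · have e : b * c - r * s = (b - r) * c + r * (c - s) := by ring
          rw [e]
          refine Ideal.add_mem _ ?_ ?_
          · have := Ideal.mul_mem_mul hr2 hc
            rwa [← pow_succ] at this
          · have := Ideal.mul_mem_mul hr1 hs2
            rwa [← pow_add] at this
      · rintro b c ⟨r, hr, hr1, hr2⟩ ⟨s, hs, hs1, hs2⟩
        refine ⟨r + s, R.add_mem hr hs, Ideal.add_mem _ hr1 hs1, ?_⟩
        rw [add_sub_add_comm]
        exact Ideal.add_mem _ hr2 hs2
  have h2 : ∀ k : ℕ, ∀ a, ∃ r ∈ R, a - r ∈ m ^ (k + 1) := by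
    intro k
    induction k with
    | zero =>
      intro a
      obtain ⟨r, hr, h⟩ := hR a
      exact ⟨r, hr, Ideal.pow_le_pow_right (by norm_num) h⟩
    | succ k ih =>
      intro a
      obtain ⟨r, hr, h⟩ := ih a
      obtain ⟨s, hs, -, h'⟩ := h1 k _ h
      exact ⟨r + s, R.add_mem hr hs, by rwa [← sub_sub]⟩
  refine eq_top_iff.2 fun a _ => ?_
  obtain ⟨r, hr, h⟩ := h2 N a
  have h3 : a - r ∈ m ^ N := Ideal.pow_le_pow_right (Nat.le_succ N) h
  rw [hN, Ideal.mem_bot, sub_eq_zero] at h3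
  rwa [h3]

variable {S : Type*} [CommRing S] [Algebra ℝ S] {n : ℕ}

/-- If `I` lies in the square of the maximal ideal, morphisms that are onto modulo `I` are onto. -/
theorem surjective_of_surjective_mod (hN : RingHom.ker ρ ^ N = ⊥) {I : Ideal A}
    (hI : I ≤ RingHom.ker ρ ^ 2) (p : S →ₐ[ℝ] A)
    (hp : Function.Surjective ((Ideal.Quotient.mkₐ ℝ I).comp p)) : Function.Surjective p := by
  rw [← AlgHom.range_eq_top]
  refine subalgebra_eq_top hN _ fun a => ?_
  obtain ⟨f, hf⟩ := hp (Ideal.Quotient.mk I a)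
  refine ⟨p f, ⟨f, rfl⟩, hI ?_⟩
  rw [← Ideal.Quotient.eq]
  exact hf.symm

/-- Frame identities hold only locally, that is, after multiplication by some `h` nonzero at the
real point. As `p h` is then invertible, `p` sees them as exact identities. -/
theorem map_eq_zero_of_mul_eq_zero (hN : RingHom.ker ρ ^ N = ⊥) (p : S →ₐ[ℝ] A) {h u : S}
    (hh : ρ (p h) ≠ 0) (hu : h * u = 0) : p u = 0 := by
  have : p h * p u = 0 := by rw [← map_mul, hu, map_zero]
  exact (isUnit_of_ne_zero hN hh).mul_right_eq_zero.1 this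

/-- A linear map satisfying the Leibniz rule relative to two morphisms over the same real point is
determined by its values on the coordinates. -/
theorem biderivation_eq_zero (hN : RingHom.ker ρ ^ N = ⊥) (F : LocalFrame S n)
    (p q : S →ₐ[ℝ] A) (hpq : ρ.comp p = ρ.comp q) (hχ : ρ (p F.χ) ≠ 0) (Δ : S →ₗ[ℝ] A)
    (hΔ : ∀ f g, Δ (f * g) = p f * Δ g + q g * Δ f) (hx : ∀ i, Δ (F.x i) = 0) : Δ = 0 := by
  have hone : Δ 1 = 0 := by simpa using hΔ 1 1
  have hc : ∀ r : ℝ, Δ (algebraMap ℝ S r) = 0 := fun r => by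
    rw [Algebra.algebraMap_eq_smul_one, map_smul, hone, smul_zero]
  -- Applying `Δ` to Hadamard's expansion leaves only the terms `p (x i - c i) * Δ (g i)`, whose
  -- first factor is in `ker ρ`: each pass gains one power.
  have hk : ∀ k : ℕ, ∀ f, Δ f ∈ RingHom.ker ρ ^ k := by
    intro k
    induction k with
    | zero => simp
    | succ k ih =>
      intro f
      obtain ⟨g, h, hh, e⟩ := F.hadamard (ρ.comp p) hχ f
      set u := f - algebraMap ℝ S (ρ.comp p f) -
        ∑ i, (F.x i - algebraMap ℝ S (ρ.comp p (F.x i))) * g i with hu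
      have hqu : q u = 0 := by
        refine map_eq_zero_of_mul_eq_zero hN q ?_ e
        rwa [hpq] at hh
      have hΔu : Δ u = 0 := by
        have := hΔ h u
        rw [e, hqu, map_zero, zero_mul, add_zero] at this
        exact (isUnit_of_ne_zero hN hh).mul_right_eq_zero.1 this.symm
      rw [hu, map_sub, map_sub, hc, sub_zero, sub_eq_zero, map_sum] at hΔu
      rw [hΔu]
      refine Ideal.sum_mem _ fun i _ => ?_
      rw [hΔ, map_sub Δ, hx, hc, sub_zero, mul_zero, add_zero, pow_succ']
      refine Ideal.mul_mem_mul ?_ (ih _)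
      simp [RingHom.mem_ker]
  ext f
  have := hk N f
  rwa [hN, Ideal.mem_bot] at this

/-- The difference `p - q` satisfies the mixed Leibniz rule with `p` on one factor and `q` on the
other, hence the two morphisms in `biderivation_eq_zero`. -/
theorem algHom_ext (hN : RingHom.ker ρ ^ N = ⊥) (F : LocalFrame S n)
    (p q : S →ₐ[ℝ] A) (hpq : ρ.comp p = ρ.comp q) (hχ : ρ (p F.χ) ≠ 0)
    (hx : ∀ i, p (F.x i) = q (F.x i)) : p = q := by
  have := biderivation_eq_zero hN F p q hpq hχ (p.toLinearMap - q.toLinearMap)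
    (fun f g => by simp; ring) (fun i => by simp [hx])
  ext f
  have := congrArg (fun Δ => Δ f) this
  simpa [sub_eq_zero] using this

theorem derivation_ext (hN : RingHom.ker ρ ^ N = ⊥) (F : LocalFrame S n)
    (p : S →ₐ[ℝ] A) (hχ : ρ (p F.χ) ≠ 0) (D E : S →ₗ[ℝ] A)
    (hD : ∀ f g, D (f * g) = p f * D g + p g * D f) (hE : ∀ f g, E (f * g) = p f * E g + p g * E f)
    (hx : ∀ i, D (F.x i) = E (F.x i)) : D = E := by
  rw [← sub_eq_zero]
  refine biderivation_eq_zero hN F p p rfl hχ _ (fun f g => ?_) (fun i => by simp [hx])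
  simp only [LinearMap.sub_apply, hD, hE]
  ring

/-- A linear form vanishing on `1`, on the square of the maximal ideal and on the images of the
coordinates vanishes on the image of the morphism. -/
theorem linearForm_comp_eq_zero (hN : RingHom.ker ρ ^ N = ⊥) (F : LocalFrame S n)
    (p : S →ₐ[ℝ] A) (hχ : ρ (p F.χ) ≠ 0) (Λ : A →ₗ[ℝ] ℝ) (h1 : Λ 1 = 0)
    (h2 : ∀ a ∈ RingHom.ker ρ ^ 2, Λ a = 0) (hx : ∀ i, Λ (p (F.x i)) = 0) (f : S) :
    Λ (p f) = 0 := by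
  have hc : ∀ r : ℝ, Λ (algebraMap ℝ A r) = 0 := fun r => by
    rw [Algebra.algebraMap_eq_smul_one, map_smul, h1, smul_zero]
  obtain ⟨g, h, hh, e⟩ := F.hadamard (ρ.comp p) hχ f
  have e2 := map_eq_zero_of_mul_eq_zero hN p hh e
  rw [map_sub, map_sub, AlgHom.commutes, sub_eq_zero, sub_eq_iff_eq_add] at e2
  rw [e2, map_add, hc, add_zero, map_sum, map_sum]
  refine Finset.sum_eq_zero fun i _ => ?_
  rw [map_mul, map_sub, AlgHom.commutes]
  set ν := p (F.x i) - algebraMap ℝ A (ρ.comp p (F.x i)) with hν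
  have hνm : ν ∈ RingHom.ker ρ := by simp [hν, RingHom.mem_ker]
  -- Replacing `p (g i)` by its real residue changes the product by an element of `m²`, which `Λ`
  -- does not see.
  have e3 : ν * p (g i) = ν * (p (g i) - algebraMap ℝ A (ρ (p (g i)))) + ρ (p (g i)) • ν := by
    rw [Algebra.smul_def]; ring
  rw [e3, map_add, map_smul, h2 _ (by
    rw [pow_two]; exact Ideal.mul_mem_mul hνm (sub_algebraMap_mem_ker ρ _)), hν, map_sub, hx, hc]
  simp

/-- The derivation over `p` with the given components. -/
noncomputable def frameDer (F : LocalFrame S n) (p : S →ₐ[ℝ] A) (v : Fin n → A) : S →ₗ[ℝ] A :=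
  ∑ i, LinearMap.mulRight ℝ (v i) ∘ₗ p.toLinearMap ∘ₗ (F.X i).toLinearMap

theorem frameDer_apply (F : LocalFrame S n) (p : S →ₐ[ℝ] A) (v : Fin n → A) (f : S) :
    frameDer F p v f = ∑ i, p (F.X i f) * v i := by
  simp [frameDer]

theorem frameDer_mul (F : LocalFrame S n) (p : S →ₐ[ℝ] A) (v : Fin n → A) (f g : S) :
    frameDer F p v (f * g) = p f * frameDer F p v g + p g * frameDer F p v f := by
  simp only [frameDer_apply, Derivation.leibniz, smul_eq_mul, map_add, map_mul, Finset.mul_sum,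
    ← Finset.sum_add_distrib]
  exact Finset.sum_congr rfl fun i _ => by ring

theorem frameDer_coord (hN : RingHom.ker ρ ^ N = ⊥) (F : LocalFrame S n) (p : S →ₐ[ℝ] A)
    (hχ : ρ (p F.χ) ≠ 0) (v : Fin n → A) (j : Fin n) : frameDer F p v (F.x j) = v j := by
  have h : ∀ i, p (F.X i (F.x j)) = if i = j then 1 else 0 := fun i => by
    have := map_eq_zero_of_mul_eq_zero hN p hχ (F.frame i j)
    rw [map_sub, sub_eq_zero] at this
    rw [this]
    split_ifs <;> simp
  simp [frameDer_apply, h]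

/-! ### Taylor expansion with nilpotent increments -/

/-- The terms of the Taylor expansion with increment `ν` at the real point `ε`. -/
noncomputable def taylorTerm (X : Fin n → Derivation ℝ S S) (ε : S →ₐ[ℝ] ℝ) (ν : Fin n → A) : ℕ → S →ₗ[ℝ] A
  | 0 => Algebra.linearMap ℝ A ∘ₗ ε.toLinearMap
  | k + 1 => ((k + 1 : ℝ)⁻¹) • ∑ i, LinearMap.mulLeft ℝ (ν i) ∘ₗ
      taylorTerm X ε ν k ∘ₗ (X i).toLinearMap

section Taylor

variable (X : Fin n → Derivation ℝ S S) (ε : S →ₐ[ℝ] ℝ) (ν : Fin n → A)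

theorem taylorTerm_zero (f : S) : taylorTerm X ε ν 0 f = algebraMap ℝ A (ε f) := rfl

theorem taylorTerm_succ (k : ℕ) (f : S) : taylorTerm X ε ν (k + 1) f =
    ((k + 1 : ℝ)⁻¹) • ∑ i, ν i * taylorTerm X ε ν k (X i f) := by
  simp [taylorTerm]

theorem sum_mul_taylorTerm (k : ℕ) (f : S) :
    ∑ i, ν i * taylorTerm X ε ν k (X i f) = ((k + 1 : ℕ) : A) * taylorTerm X ε ν (k + 1) f := by
  have h : ((k + 1 : ℕ) : A) = algebraMap ℝ A (k + 1 : ℝ) := by simp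
  rw [taylorTerm_succ, h, ← Algebra.smul_def, smul_smul, mul_inv_cancel₀ (by positivity), one_smul]

/-- The terms come from the divided powers `D^k / k!` of the single derivation `D = ∑ ν i X i` on `A
⊗ S`, so this is the Leibniz formula, and the `X i` need not commute. -/
theorem taylorTerm_mul (k : ℕ) : ∀ f g : S, taylorTerm X ε ν k (f * g) =
    ∑ ab ∈ Finset.HasAntidiagonal.antidiagonal k, taylorTerm X ε ν ab.1 f * taylorTerm X ε ν ab.2 g := by
  induction k with
  | zero => intro f g; simp [taylorTerm_zero]
  | succ k ih =>
    intro f g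
    set T := taylorTerm X ε ν with hT
    have e1 : ∑ i, ν i * T k (X i (f * g)) =
        ∑ ab ∈ Finset.HasAntidiagonal.antidiagonal k, (((ab.1 + 1 : ℕ) : A) * T (ab.1 + 1) f * T ab.2 g) +
        ∑ ab ∈ Finset.HasAntidiagonal.antidiagonal k, (((ab.2 + 1 : ℕ) : A) * T ab.1 f * T (ab.2 + 1) g) := by
      have e2 : ∀ i, ν i * T k (X i (f * g)) =
          ∑ ab ∈ Finset.HasAntidiagonal.antidiagonal k, (ν i * T ab.1 (X i f)) * T ab.2 g +
          ∑ ab ∈ Finset.HasAntidiagonal.antidiagonal k, T ab.1 f * (ν i * T ab.2 (X i g)) := by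
        intro i
        rw [Derivation.leibniz, smul_eq_mul, smul_eq_mul, map_add, ih, mul_comm g, ih, mul_add,
          add_comm, Finset.mul_sum, Finset.mul_sum]
        congr 1 <;> exact Finset.sum_congr rfl fun ab _ => by ring
      rw [Finset.sum_congr rfl fun i _ => e2 i, Finset.sum_add_distrib, Finset.sum_comm,
        Finset.sum_comm (s := Finset.univ)]
      congr 1 <;> refine Finset.sum_congr rfl fun ab _ => ?_
      · rw [← Finset.sum_mul, sum_mul_taylorTerm]
      · rw [← Finset.mul_sum, sum_mul_taylorTerm]; ring
    -- The extra boundary term of the longer antidiagonal has weight zero. After both reindexings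
    -- the weights `ab.1` and `ab.2` add up to `k + 1`, cancelling the denominator.
    have e3 : ∑ ab ∈ Finset.HasAntidiagonal.antidiagonal k, (((ab.1 + 1 : ℕ) : A) * T (ab.1 + 1) f * T ab.2 g) =
        ∑ ab ∈ Finset.HasAntidiagonal.antidiagonal (k + 1), ((ab.1 : A) * T ab.1 f * T ab.2 g) := by
      rw [Finset.Nat.sum_antidiagonal_succ]; simp
    have e4 : ∑ ab ∈ Finset.HasAntidiagonal.antidiagonal k, (((ab.2 + 1 : ℕ) : A) * T ab.1 f * T (ab.2 + 1) g) =
        ∑ ab ∈ Finset.HasAntidiagonal.antidiagonal (k + 1), ((ab.2 : A) * T ab.1 f * T ab.2 g) := by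
      rw [Finset.Nat.sum_antidiagonal_succ']; simp
    rw [hT, taylorTerm_succ, ← hT, e1, e3, e4, ← Finset.sum_add_distrib]
    have e5 : ∀ ab ∈ Finset.HasAntidiagonal.antidiagonal (k + 1),
        (ab.1 : A) * T ab.1 f * T ab.2 g + (ab.2 : A) * T ab.1 f * T ab.2 g =
        algebraMap ℝ A (k + 1 : ℝ) * (T ab.1 f * T ab.2 g) := by
      intro ab hab
      rw [← add_mul, ← add_mul, ← Nat.cast_add, Finset.HasAntidiagonal.mem_antidiagonal.1 hab]
      simp; ring
    rw [Finset.sum_congr rfl e5, ← Finset.mul_sum, ← Algebra.smul_def, smul_smul,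
      inv_mul_cancel₀ (by positivity), one_smul]

theorem taylorTerm_mem (hν : ∀ i, ν i ∈ RingHom.ker ρ) (k : ℕ) :
    ∀ f, taylorTerm X ε ν k f ∈ RingHom.ker ρ ^ k := by
  induction k with
  | zero => simp
  | succ k ih =>
    intro f
    rw [taylorTerm_succ, Algebra.smul_def]
    refine Ideal.mul_mem_left _ _ (Ideal.sum_mem _ fun i _ => ?_)
    rw [pow_succ']
    exact Ideal.mul_mem_mul (hν i) (ih _)

/-- The Taylor expansion at a real point with nilpotent increments is a morphism. -/
noncomputable def taylorHom (hN : RingHom.ker ρ ^ N = ⊥) (hν : ∀ i, ν i ∈ RingHom.ker ρ) : S →ₐ[ℝ] A :=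
  AlgHom.ofLinearMap (∑ k ∈ Finset.range (N + 1), taylorTerm X ε ν k)
    (by
      rw [LinearMap.sum_apply, Finset.sum_eq_single_of_mem 0 (by simp)]
      · simp [taylorTerm_zero]
      · intro k _ hk
        obtain ⟨k, rfl⟩ := Nat.exists_eq_succ_of_ne_zero hk
        simp [taylorTerm_succ])
    (by
      intro f g
      have hz : ∀ k, N < k → ∀ f, taylorTerm X ε ν k f = 0 := fun k hk f => by
        have := Ideal.pow_le_pow_right hk.le (taylorTerm_mem X ε ν hν k f)
        rwa [hN, Ideal.mem_bot] at this
      -- With the terms as coefficients, multiplicativity is checked coefficientwise and then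
      -- evaluated at `1`. The truncation is harmless because the omitted terms vanish.
      let Q : S → Polynomial A := fun f =>
        ∑ k ∈ Finset.range (N + 1), Polynomial.monomial k (taylorTerm X ε ν k f)
      have hQ : ∀ f k, (Q f).coeff k = taylorTerm X ε ν k f := by
        intro f k
        simp only [Q, Polynomial.finsetSum_coeff, Polynomial.coeff_monomial, Finset.sum_ite_eq',
          Finset.mem_range]
        split_ifs with h
        · rfl
        · exact (hz k (by omega) f).symm
      have hQe : ∀ f, (∑ k ∈ Finset.range (N + 1), taylorTerm X ε ν k) f = (Q f).eval 1 := by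
        intro f
        simp [Q, Polynomial.eval_finsetSum]
      have hQm : Q (f * g) = Q f * Q g := by
        ext k
        rw [Polynomial.coeff_mul, hQ, taylorTerm_mul]
        simp only [hQ]
      rw [hQe, hQe, hQe, hQm, Polynomial.eval_mul])

variable {X ε ν}

theorem taylorHom_apply (hN : RingHom.ker ρ ^ N = ⊥) (hν : ∀ i, ν i ∈ RingHom.ker ρ) (f : S) :
    taylorHom X ε ν hN hν f = ∑ k ∈ Finset.range (N + 1), taylorTerm X ε ν k f := by
  simp [taylorHom]

theorem comp_taylorHom (hN : RingHom.ker ρ ^ N = ⊥) (hν : ∀ i, ν i ∈ RingHom.ker ρ) :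
    ρ.comp (taylorHom X ε ν hN hν) = ε := by
  ext f
  rw [AlgHom.comp_apply, taylorHom_apply, Finset.sum_range_succ', map_add, map_sum,
    Finset.sum_eq_zero, taylorTerm_zero]
  · simp
  · intro k _
    exact Ideal.pow_le_self (Nat.succ_ne_zero k) (taylorTerm_mem X ε ν hν (k + 1) f)

end Taylor

/-- Locally `X i (x j)` is the constant `δ i j`: the first-order term is `ν j`, and a further
derivative kills the higher ones. -/
theorem taylorHom_coord (F : LocalFrame S n) {ε : S →ₐ[ℝ] ℝ} (hχ : ε F.χ ≠ 0) {ν : Fin n → A}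
    (hN : RingHom.ker ρ ^ N = ⊥) (hν : ∀ i, ν i ∈ RingHom.ker ρ) (j : Fin n) :
    taylorHom F.X ε ν hN hν (F.x j) = algebraMap ℝ A (ε (F.x j)) + ν j := by
  -- Each term depends only on the germ at `ε`: differentiating `h * u = 0` and multiplying by `h`
  -- gives `h * h * X i u = 0`, so the induction passes from the multiplier `h` to `h * h`.
  have hzero : ∀ k, ∀ h u : S, ε h ≠ 0 → h * u = 0 → taylorTerm F.X ε ν k u = 0 := by
    intro k
    induction k with
    | zero =>
      intro h u hh hu
      have : ε h * ε u = 0 := by rw [← map_mul, hu, map_zero]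
      rw [taylorTerm_zero, (mul_eq_zero_iff_left hh).1 this, map_zero]
    | succ k ih =>
      intro h u hh hu
      rw [taylorTerm_succ, Finset.sum_eq_zero, smul_zero]
      intro i _
      rw [ih (h * h) (F.X i u) (by simpa using hh), mul_zero]
      have := F.X i |>.leibniz h u
      rw [hu, map_zero, smul_eq_mul, smul_eq_mul] at this
      linear_combination (- h) * this - F.X i h * hu
  have hX : ∀ k i, taylorTerm F.X ε ν k (F.X i (F.x j)) =
      taylorTerm F.X ε ν k (if i = j then 1 else 0) := by
    intro k i
    have := hzero k F.χ _ hχ (F.frame i j)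
    rwa [map_sub, sub_eq_zero] at this
  have hterm : ∀ k, taylorTerm F.X ε ν (k + 2) (F.x j) = 0 := by
    intro k
    rw [taylorTerm_succ, Finset.sum_eq_zero, smul_zero]
    intro i _
    rw [hX, taylorTerm_succ, Finset.sum_eq_zero, smul_zero, mul_zero]
    intro l _
    split_ifs <;> simp
  have h1 : taylorTerm F.X ε ν 1 (F.x j) = ν j := by
    rw [taylorTerm_succ]
    simp only [hX]
    simp [taylorTerm_zero, apply_ite]
  rw [taylorHom_apply]
  -- For `N = 0` the sum has no first-order term, but then `A` is zero.
  rcases N with _ | N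
  · have h0 : ∀ a : A, a = 0 := fun a => by
      have : a ∈ RingHom.ker ρ ^ 0 := by simp
      rwa [hN, Ideal.mem_bot] at this
    rw [h0 (ν j), h0 (algebraMap _ _ _), h0 (Finset.sum _ _), add_zero]
  · rw [Finset.sum_range_succ', Finset.sum_range_succ', Finset.sum_eq_zero fun k _ => hterm k,
      zero_add, h1, taylorTerm_zero, add_comm]

/-- The sum of a morphism and a derivation with values in an ideal of square zero. -/
noncomputable def addDer (p : S →ₐ[ℝ] A) (D : S →ₗ[ℝ] A) (hD : ∀ f g, D (f * g) = p f * D g + p g * D f)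
    (h0 : ∀ f g, D f * D g = 0) : S →ₐ[ℝ] A :=
  AlgHom.ofLinearMap (p.toLinearMap + D)
    (by have h : D 1 = 0 := by simpa using hD 1 1
        simp [h])
    (by intro f g
        simp only [LinearMap.add_apply, AlgHom.toLinearMap_apply, map_mul, hD]
        linear_combination - h0 f g)

theorem addDer_apply (p : S →ₐ[ℝ] A) (D : S →ₗ[ℝ] A)
    (hD : ∀ f g, D (f * g) = p f * D g + p g * D f) (h0 : ∀ f g, D f * D g = 0) (f : S) :
    addDer p D hD h0 f = p f + D f := rfl

end WeilAlgebra

/-! ### Hadamard's lemma in Euclidean space -/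

section Analysis

open MeasureTheory

/-- Differentiation under the integral sign, iterated. The target `F` is quantified inside the
induction because the derivative takes values in `E →L[ℝ] F`. -/
theorem contDiff_parametric_integral {E : Type} [NormedAddCommGroup E] [NormedSpace ℝ E]
    [FiniteDimensional ℝ E] (k : ℕ) : ∀ {F : Type} [NormedAddCommGroup F] [NormedSpace ℝ F]
    (H : E × ℝ → F), ContDiff ℝ ∞ H →
    ContDiff ℝ k (fun z => ∫ t in (0 : ℝ)..1, H (z, t)) := by
  have hderiv : ∀ {F : Type} [NormedAddCommGroup F] [NormedSpace ℝ F] (H : E × ℝ → F),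
      ContDiff ℝ ∞ H → ∀ z : E, HasFDerivAt (fun z => ∫ t in (0 : ℝ)..1, H (z, t))
        (∫ t in (0 : ℝ)..1, (fderiv ℝ H (z, t)).comp (ContinuousLinearMap.inl ℝ E ℝ)) z := by
    intro F _ _ H hH z
    have hc : Continuous fun w : E × ℝ => (fderiv ℝ H w).comp (ContinuousLinearMap.inl ℝ E ℝ) :=
      (hH.continuous_fderiv (by simp)).clm_comp continuous_const
    obtain ⟨C, hC⟩ := ((isCompact_closedBall z 1).prod
      (isCompact_Icc (a := (0 : ℝ)) (b := 1))).exists_bound_of_continuousOn hc.continuousOn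
    refine intervalIntegral.hasFDerivAt_integral_of_dominated_of_fderiv_le
      (F := fun z t => H (z, t))
      (F' := fun z t => (fderiv ℝ H (z, t)).comp (ContinuousLinearMap.inl ℝ E ℝ))
      (bound := fun _ => C)
      (Metric.closedBall_mem_nhds z one_pos) ?_ ?_ ?_ ?_ ?_ ?_
    · refine Filter.Eventually.of_forall fun x => Continuous.aestronglyMeasurable ?_
      exact hH.continuous.comp (by fun_prop)
    · refine Continuous.intervalIntegrable ?_ _ _
      exact hH.continuous.comp (by fun_prop)
    · exact (hc.comp (by fun_prop : Continuous fun t : ℝ => (z, t))).aestronglyMeasurable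
    · refine Filter.Eventually.of_forall fun t ht x hx => hC (x, t) ⟨hx, ?_⟩
      rw [Set.uIoc_of_le zero_le_one] at ht
      exact Set.Ioc_subset_Icc_self ht
    · exact intervalIntegrable_const
    · refine Filter.Eventually.of_forall fun t ht x hx => ?_
      exact ((hH.differentiable (by simp)) (x, t)).hasFDerivAt.comp x
        ((hasFDerivAt_id x).prodMk (hasFDerivAt_const t x))
  induction k with
  | zero =>
    intro F _ _ H hH
    rw [Nat.cast_zero, contDiff_zero]
    exact continuous_iff_continuousAt.2 fun z => (hderiv H hH z).continuousAt
  | succ k ih =>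
    intro F _ _ H hH
    rw [Nat.cast_succ, contDiff_succ_iff_hasFDerivAt]
    refine ⟨_, ih (fun w => (fderiv ℝ H w).comp (ContinuousLinearMap.inl ℝ E ℝ)) ?_, hderiv H hH⟩
    exact (hH.fderiv_right (by simp)).clm_comp contDiff_const

/-- Hadamard's lemma. -/
theorem exists_hadamard {n : ℕ} (F : EuclideanSpace ℝ (Fin n) → ℝ) (hF : ContDiff ℝ ∞ F)
    (c : EuclideanSpace ℝ (Fin n)) : ∃ G : Fin n → EuclideanSpace ℝ (Fin n) → ℝ,
      (∀ i, ContDiff ℝ ∞ (G i)) ∧ ∀ z, F z = F c + ∑ i, (z i - c i) * G i z := by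
  have hd : ContDiff ℝ ∞ (fderiv ℝ F) := hF.fderiv_right (by simp)
  refine ⟨fun i z => ∫ t in (0 : ℝ)..1, fderiv ℝ F (c + t • (z - c)) (EuclideanSpace.single i 1),
    fun i => contDiff_infty.2 fun k => ?_, fun z => ?_⟩
  · refine contDiff_parametric_integral k
      (fun w : EuclideanSpace ℝ (Fin n) × ℝ =>
        fderiv ℝ F (c + w.2 • (w.1 - c)) (EuclideanSpace.single i 1)) ?_
    exact (hd.comp (by fun_prop)).clm_apply contDiff_const
  · have h1 : ∀ t : ℝ, HasDerivAt (fun t : ℝ => F (c + t • (z - c)))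
        (fderiv ℝ F (c + t • (z - c)) (z - c)) t := by
      intro t
      have h2 : HasDerivAt (fun t : ℝ => c + t • (z - c)) (z - c) t := by
        simpa using ((hasDerivAt_id t).smul_const (z - c)).const_add c
      exact ((hF.differentiable (by simp)) _).hasFDerivAt.comp_hasDerivAt t h2
    have hcont : ∀ v : EuclideanSpace ℝ (Fin n),
        Continuous fun t : ℝ => fderiv ℝ F (c + t • (z - c)) v := fun v =>
      (hd.continuous.comp (by fun_prop)).clm_apply continuous_const
    have h3 := intervalIntegral.integral_eq_sub_of_hasDerivAt (a := 0) (b := 1)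
      (fun t _ => h1 t) ((hcont _).intervalIntegrable _ _)
    have h4 : ∀ t : ℝ, fderiv ℝ F (c + t • (z - c)) (z - c) =
        ∑ i, (z i - c i) * fderiv ℝ F (c + t • (z - c)) (EuclideanSpace.single i 1) := by
      intro t
      generalize fderiv ℝ F (c + t • (z - c)) = T
      conv_lhs => rw [← (EuclideanSpace.basisFun (Fin n) ℝ).sum_repr (z - c)]
      simp [map_sum]
    simp only [h4] at h3
    rw [intervalIntegral.integral_finsetSum
      fun i _ => ((hcont _).const_mul _).intervalIntegrable _ _] at h3
    simp only [intervalIntegral.integral_const_mul, one_smul, zero_smul, add_zero] at h3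
    rw [h3]
    simp

end Analysis

/-! ### Real points and local frames of a manifold -/

section ManifoldAlgebra

variable {n : ℕ} {M : Type*} [TopologicalSpace M] [ChartedSpace (EuclideanSpace ℝ (Fin n)) M]

/-- Evaluation at a point. -/
noncomputable def evalPoint (y : M) : SmoothFun n M →ₐ[ℝ] ℝ where
  toFun f := f y
  map_one' := rfl
  map_mul' _ _ := rfl
  map_zero' := rfl
  map_add' _ _ := rfl
  commutes' _ := rfl

theorem SmoothFun.isUnit_of_ne_zero (h : SmoothFun n M) (hh : ∀ y, h y ≠ 0) : IsUnit h := by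
  refine IsUnit.of_mul_eq_one
    (⟨fun y => (h y)⁻¹, fun y => (h.contMDiff y).inv₀ (hh y)⟩ : SmoothFun n M) ?_
  ext y
  exact mul_inv_cancel₀ (hh y)

theorem SmoothFun.isUnit_sq_add_one (f : SmoothFun n M) : IsUnit (f ^ 2 + 1) :=
  SmoothFun.isUnit_of_ne_zero _ fun y => by
    change f y ^ 2 + 1 ≠ 0
    positivity

/-- Milnor's exercise: the real points of a manifold are its points. -/
theorem exists_eq_evalPoint [IsManifold (𝓡 n) ∞ M] [T2Space M] [SecondCountableTopology M]
    (ε : SmoothFun n M →ₐ[ℝ] ℝ) : ∃ y : M, ε = evalPoint y := by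
  have : LocallyCompactSpace M := ChartedSpace.locallyCompactSpace (EuclideanSpace ℝ (Fin n)) M
  have : SigmaCompactSpace M := sigmaCompactSpace_of_locallyCompact_secondCountable
  let K : CompactExhaustion M := default
  -- A proper function: its sublevel sets lie in members of the exhaustion.
  obtain ⟨g, hg⟩ : ∃ g : SmoothFun n M, ∀ x, g x ∈ Set.Ici (K.find x : ℝ) :=
    exists_contMDiffMap_forall_mem_convex_of_local_const (n := ⊤) (𝓡 n)
    (t := fun x : M => Set.Ici (K.find x : ℝ)) (fun x => convex_Ici _) (fun x => by
      refine ⟨(K.find x + 1 : ℕ), ?_⟩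
      have h1 : K (K.find x + 1) ∈ 𝓝 x :=
        mem_interior_iff_mem_nhds.1 (K.subset_interior_succ _ (K.mem_find x))
      filter_upwards [h1] with y hy
      rw [Set.mem_Ici, Nat.cast_le]
      exact K.mem_iff_find_le.1 hy)
  by_contra! hcon
  have h2 : ∀ x : M, ∃ u : SmoothFun n M, ε u = 0 ∧ u x ≠ 0 := by
    intro x
    obtain ⟨f, hf⟩ := DFunLike.ne_iff.1 (hcon x)
    refine ⟨f - algebraMap ℝ _ (ε f), by simp, ?_⟩
    intro h0
    exact hf (sub_eq_zero.1 h0).symm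
  choose u hu hux using h2
  obtain ⟨t, -, ht⟩ := (K.isCompact ⌊ε g⌋₊).elim_finite_subcover_image
    (b := Set.univ) (c := fun x => {y | u x y ≠ 0})
    (fun x _ => isOpen_ne_fun (u x).contMDiff.continuous continuous_const)
    (fun y _ => Set.mem_biUnion (Set.mem_univ y) (hux y))
  obtain ⟨htf, ht⟩ := ht
  -- The square vanishes only on a level set of `g` inside the compact set, where some `u x` is
  -- nonzero. So `h` is invertible although `ε h = 0`.
  let h : SmoothFun n M := (g - algebraMap ℝ _ (ε g)) ^ 2 + ∑ x ∈ htf.toFinset, u x ^ 2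
  have h0 : ε h = 0 := by simp [h, hu]
  have hy : ∀ y, h y = (g y - ε g) ^ 2 + ∑ x ∈ htf.toFinset, u x y ^ 2 := by
    intro y
    have : evalPoint y h = (evalPoint y g - ε g) ^ 2 +
        ∑ x ∈ htf.toFinset, evalPoint y (u x) ^ 2 := by simp [h]
    exact this
  have hunit : IsUnit h := by
    refine SmoothFun.isUnit_of_ne_zero h fun y hy0 => ?_
    rw [hy] at hy0
    have hs : 0 ≤ ∑ x ∈ htf.toFinset, u x y ^ 2 := Finset.sum_nonneg fun _ _ => sq_nonneg _
    have e1 : (g y - ε g) ^ 2 = 0 := by nlinarith [sq_nonneg (g y - ε g)]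
    have e2 : ∑ x ∈ htf.toFinset, u x y ^ 2 = 0 := by nlinarith [sq_nonneg (g y - ε g)]
    have e3 : g y = ε g := by
      have := pow_eq_zero_iff (two_ne_zero) |>.1 e1
      linarith
    have hyK : y ∈ K ⌊ε g⌋₊ := by
      rw [K.mem_iff_find_le]
      refine Nat.le_floor ?_
      rw [← e3]
      exact hg y
    obtain ⟨x, hx, hxy⟩ := Set.mem_iUnion₂.1 (ht hyK)
    have := (Finset.sum_eq_zero_iff_of_nonneg fun _ _ => sq_nonneg _).1 e2 x
      (htf.mem_toFinset.2 hx)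
    exact hxy (pow_eq_zero_iff (two_ne_zero) |>.1 this)
  exact (hunit.map ε).ne_zero h0

/-- A manifold has a local frame around each point. -/
theorem exists_localFrame [IsManifold (𝓡 n) ∞ M] [T2Space M] [SecondCountableTopology M]
    (ε : SmoothFun n M →ₐ[ℝ] ℝ) : ∃ F : LocalFrame (SmoothFun n M) n, ε F.χ ≠ 0 := by
  obtain ⟨y₀, rfl⟩ := exists_eq_evalPoint ε
  let e := extChartAt (𝓡 n) y₀
  -- The cutoff `ψ` makes chart coordinates and partial derivatives global; they are the true ones
  -- where `ψ = 1`.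
  let ψ : SmoothBumpFunction (𝓡 n) y₀ := Classical.arbitrary _
  have hsource : e.source = (chartAt (EuclideanSpace ℝ (Fin n)) y₀).source :=
    extChartAt_source (𝓡 n) y₀
  have htarget : IsOpen e.target := isOpen_extChartAt_target y₀
  have hball : Metric.closedBall (e y₀) ψ.rOut ⊆ e.target := by
    have := ψ.closedBall_subset
    rwa [ModelWithCorners.range_eq_univ, Set.inter_univ] at this
  have hψ0 : ∀ y, y ∉ e.source → ψ y = 0 := fun y hy => by
    by_contra h
    exact hy (hsource ▸ ψ.support_subset_source h)
  have hsmooth : ∀ f : SmoothFun n M, ContDiffOn ℝ ∞ (f ∘ e.symm) e.target := fun f => by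
    rw [← contMDiffOn_iff_contDiffOn]
    exact f.contMDiff.comp_contMDiffOn (contMDiffOn_extChartAt_symm y₀)
  have hdiff : ∀ (f : SmoothFun n M) y, y ∈ e.source → DifferentiableAt ℝ (f ∘ e.symm) (e y) :=
    fun f y hy => ((hsmooth f).differentiableOn (by simp)).differentiableAt
      (htarget.mem_nhds (e.map_source hy))
  have hchart : ContMDiffOn (𝓡 n) 𝓘(ℝ, EuclideanSpace ℝ (Fin n)) ∞ e
      (chartAt (EuclideanSpace ℝ (Fin n)) y₀).source := contMDiffOn_extChartAt
  have hX : ∀ (f : SmoothFun n M) (v : EuclideanSpace ℝ (Fin n)), ContMDiff (𝓡 n) 𝓘(ℝ, ℝ) ∞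
      fun y => ψ y • fderiv ℝ (f ∘ e.symm) (e y) v := fun f v => by
    refine ψ.contMDiff_smul ?_
    have h1 : ContDiffOn ℝ ∞ (fun z => fderiv ℝ (f ∘ e.symm) z v) e.target :=
      ((hsmooth f).fderiv_of_isOpen htarget (by simp)).clm_apply contDiffOn_const
    refine h1.contMDiffOn.comp hchart fun y hy => e.map_source (hsource ▸ hy)
  let X : Fin n → Derivation ℝ (SmoothFun n M) (SmoothFun n M) := fun i =>
    Derivation.mk'
      { toFun := fun f => ⟨_, hX f (EuclideanSpace.single i 1)⟩
        map_add' := fun f g => by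
          ext y
          change ψ y • fderiv ℝ ((f ∘ e.symm) + (g ∘ e.symm)) (e y) _ =
            ψ y • fderiv ℝ (f ∘ e.symm) (e y) _ + ψ y • fderiv ℝ (g ∘ e.symm) (e y) _
          by_cases hy : y ∈ e.source
          · rw [fderiv_add (hdiff f y hy) (hdiff g y hy), add_apply, smul_add]
          · simp [hψ0 y hy]
        map_smul' := fun r f => by
          ext y
          change ψ y • fderiv ℝ (r • (f ∘ e.symm)) (e y) _ =
            r • (ψ y • fderiv ℝ (f ∘ e.symm) (e y) _)
          by_cases hy : y ∈ e.source
          · rw [fderiv_const_smul (hdiff f y hy), smul_apply, smul_comm]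
          · simp [hψ0 y hy] }
      (fun f g => by
        ext y
        change ψ y • fderiv ℝ ((f ∘ e.symm) * (g ∘ e.symm)) (e y) _ =
            f y * (ψ y • fderiv ℝ (g ∘ e.symm) (e y) _) +
            g y * (ψ y • fderiv ℝ (f ∘ e.symm) (e y) _)
        by_cases hy : y ∈ e.source
        · rw [fderiv_mul (hdiff f y hy) (hdiff g y hy)]
          simp only [Function.comp_apply, e.left_inv hy, add_apply,
            smul_apply, smul_eq_mul]
          ring
        · simp [hψ0 y hy])
  have hbump : ∀ G : EuclideanSpace ℝ (Fin n) → ℝ, ContDiff ℝ ∞ G →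
      ContMDiff (𝓡 n) 𝓘(ℝ, ℝ) ∞ fun y => ψ y • G (e y) := fun G hG =>
    ψ.contMDiff_smul (hG.contMDiff.comp_contMDiffOn hchart)
  let x : Fin n → SmoothFun n M := fun i => ⟨_, hbump (fun z => z i) (by fun_prop)⟩
  -- The outer radius is `ψ.rIn`, so that `φ` is supported where `ψ = 1`.
  let φ : SmoothBumpFunction (𝓡 n) y₀ :=
    ⟨⟨ψ.rIn / 2, ψ.rIn, half_pos ψ.rIn_pos, half_lt_self ψ.rIn_pos⟩,
      (Set.inter_subset_inter_left _ (Metric.closedBall_subset_closedBall ψ.rIn_lt_rOut.le)).trans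
        ψ.closedBall_subset⟩
  let χ : SmoothFun n M := ⟨φ, φ.contMDiff⟩
  have hχ : ∀ y, χ y ≠ 0 → y ∈ e.source ∧ e y ∈ Metric.ball (e y₀) ψ.rIn := fun y hy => by
    have : y ∈ Function.support φ := hy
    rw [φ.support_eq_inter_preimage] at this
    exact ⟨hsource ▸ this.1, this.2⟩
  have hψ1 : ∀ y ∈ e.source, e y ∈ Metric.ball (e y₀) ψ.rIn → ψ y = 1 := fun y hy hy' =>
    ψ.one_of_dist_le (hsource ▸ hy) (Metric.mem_ball.1 hy').le
  have hin : Metric.ball (e y₀) ψ.rIn ⊆ e.target :=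
    (Metric.ball_subset_closedBall.trans
      (Metric.closedBall_subset_closedBall ψ.rIn_lt_rOut.le)).trans hball
  refine ⟨⟨χ, x, X, ?_, ?_⟩, ?_⟩
  · intro i j
    ext y
    change χ y * (ψ y • fderiv ℝ (x j ∘ e.symm) (e y) (EuclideanSpace.single i 1) -
      evalPoint y (if i = j then 1 else 0 : SmoothFun n M)) = 0
    by_cases hy : χ y = 0
    · rw [hy, zero_mul]
    · obtain ⟨h1, h2⟩ := hχ y hy
      have h3 : x j ∘ e.symm =ᶠ[𝓝 (e y)] EuclideanSpace.proj (𝕜 := ℝ) j := by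
        filter_upwards [Metric.isOpen_ball.mem_nhds h2] with z hz
        have hz' := e.map_target (hin hz)
        have hz'' := e.right_inv (hin hz)
        change ψ (e.symm z) • (e (e.symm z)) j = z j
        rw [hψ1 _ hz' (by rwa [hz'']), hz'', one_smul]
      rw [h3.fderiv_eq, ContinuousLinearMap.fderiv, hψ1 y h1 h2]
      split_ifs with hij
      · simp [hij]
      · simp [hij]
  · intro ε' hε f
    obtain ⟨y, rfl⟩ := exists_eq_evalPoint ε'
    obtain ⟨hy1, hy2⟩ := hχ y hε
    -- Hadamard's lemma needs a function on the whole Euclidean space; the bump extends `f ∘ e.symm`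
    -- by zero outside the chart.
    have hF : ContDiff ℝ ∞ fun z => ψ.toContDiffBump z • (f ∘ e.symm) z := by
      rw [contDiff_iff_contDiffAt]
      intro z
      by_cases hz : z ∈ e.target
      · exact ψ.toContDiffBump.contDiffAt.smul ((hsmooth f).contDiffAt (htarget.mem_nhds hz))
      · have hz' : z ∉ tsupport ψ.toContDiffBump := fun h => by
          rw [ψ.toContDiffBump.tsupport_eq] at h
          exact hz (hball h)
        have := notMem_tsupport_iff_eventuallyEq.1 hz'
        refine contDiffAt_const (c := (0 : ℝ)) |>.congr_of_eventuallyEq ?_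
        filter_upwards [this] with w hw
        rw [hw, Pi.zero_apply, zero_smul]
    obtain ⟨G, hG, hGF⟩ := exists_hadamard _ hF (e y)
    let g : Fin n → SmoothFun n M := fun i => ⟨_, hbump (G i) (hG i)⟩
    refine ⟨g, χ, hε, ?_⟩
    ext z
    by_cases hz : χ z = 0
    · change χ z * _ = 0
      rw [hz, zero_mul]
    · obtain ⟨hz1, hz2⟩ := hχ z hz
      have key : f z = f y + ∑ i, (x i z - x i y) * (ψ z • G i (e z)) := by
        have h1 : ∀ w ∈ e.source, e w ∈ Metric.ball (e y₀) ψ.rIn →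
            ψ.toContDiffBump (e w) • (f ∘ e.symm) (e w) = f w := fun w hw hw' => by
          rw [ψ.toContDiffBump.one_of_mem_closedBall (Metric.ball_subset_closedBall hw'), one_smul,
            Function.comp_apply, e.left_inv hw]
        have h2 := hGF (e z)
        rw [h1 z hz1 hz2, h1 y hy1 hy2] at h2
        rw [h2]
        congr 1
        refine Finset.sum_congr rfl fun i _ => ?_
        change _ = (ψ z • e z i - ψ y • e y i) * _
        rw [hψ1 z hz1 hz2, hψ1 y hy1 hy2, one_smul, one_smul, one_smul]
      have : evalPoint z (χ * (f - algebraMap ℝ _ (evalPoint y f) - ∑ i,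
          (x i - algebraMap ℝ _ (evalPoint y (x i))) * g i)) = 0 := by
        simp only [map_mul, map_sub, map_sum, AlgHom.commutes]
        change χ z * (f z - f y - ∑ i, (x i z - x i y) * (ψ z • G i (e z))) = 0
        rw [key]
        ring
      exact this
  · change φ y₀ ≠ 0
    rw [φ.eq_one]
    exact one_ne_zero

end ManifoldAlgebra

/-! ### Calculus of smooth functions and vector-valued maps -/

namespace SmoothSpace

variable {X : Type*} [SmoothSpace X]

theorem isSmoothFun_const (r : ℝ) : IsSmoothFun (fun _ : X => r) := fun _ =>
  ⟨Set.univ, @isOpen_univ X (topology X), trivial, 0, Fin.elim0, fun _ => r, fun j => j.elim0,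
    contDiff_const, fun _ _ => rfl⟩

theorem isSmoothFun_of_mem {c : X → ℝ} (hc : c ∈ coord (X := X)) : IsSmoothFun c := fun _ =>
  ⟨Set.univ, @isOpen_univ X (topology X), trivial, 1, fun _ => c, fun v => v 0, fun _ => hc,
    by fun_prop, fun _ _ => rfl⟩

theorem IsSmoothFun.comp₂ {φ : ℝ × ℝ → ℝ} (hφ : ContDiff ℝ ∞ φ) {f g : X → ℝ}
    (hf : IsSmoothFun f) (hg : IsSmoothFun g) : IsSmoothFun (fun x => φ (f x, g x)) := by
  intro x
  obtain ⟨U, hU, hxU, m, c, G, hc, hG, hfG⟩ := hf x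
  obtain ⟨V, hV, hxV, l, d, H, hd, hH, hgH⟩ := hg x
  refine ⟨U ∩ V, @IsOpen.inter X (topology X) U V hU hV, ⟨hxU, hxV⟩, m + l, Fin.append c d,
    fun v => φ (G fun i => v (Fin.castAdd l i), H fun i => v (Fin.natAdd m i)), ?_, ?_, ?_⟩
  · intro j
    refine Fin.addCases (fun i => ?_) (fun i => ?_) j
    · rw [Fin.append_left]; exact hc i
    · rw [Fin.append_right]; exact hd i
  · exact hφ.comp ((hG.comp (by fun_prop)).prodMk (hH.comp (by fun_prop)))
  · rintro y ⟨hyU, hyV⟩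
    simp only [Fin.append_left, Fin.append_right]
    rw [hfG y hyU, hgH y hyV]

theorem IsSmoothFun.add {f g : X → ℝ} (hf : IsSmoothFun f) (hg : IsSmoothFun g) :
    IsSmoothFun (fun x => f x + g x) :=
  IsSmoothFun.comp₂ (φ := fun z => z.1 + z.2) (by fun_prop) hf hg

theorem IsSmoothFun.mul {f g : X → ℝ} (hf : IsSmoothFun f) (hg : IsSmoothFun g) :
    IsSmoothFun (fun x => f x * g x) :=
  IsSmoothFun.comp₂ (φ := fun z => z.1 * z.2) (by fun_prop) hf hg

theorem IsSmoothFun.sum {ι : Type*} (s : Finset ι) {f : ι → X → ℝ}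
    (hf : ∀ i ∈ s, IsSmoothFun (f i)) : IsSmoothFun (fun x => ∑ i ∈ s, f i x) := by
  classical
  induction s using Finset.induction_on with
  | empty => simpa using isSmoothFun_const 0
  | insert i s hi ih =>
    simp only [Finset.sum_insert hi]
    exact (hf i (Finset.mem_insert_self i s)).add
      (ih fun j hj => hf j (Finset.mem_insert_of_mem hj))

/-- A map to a finite-dimensional vector space is smooth if its components are. -/
def IsSmoothVec {V : Type*} [AddCommGroup V] [Module ℝ V] (F : X → V) : Prop :=
  ∀ ℓ : Module.Dual ℝ V, IsSmoothFun fun x => ℓ (F x)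

section Vec

variable {V W : Type*} [AddCommGroup V] [Module ℝ V] [AddCommGroup W] [Module ℝ W]

theorem IsSmoothVec.add {F G : X → V} (hF : IsSmoothVec F) (hG : IsSmoothVec G) :
    IsSmoothVec (fun x => F x + G x) := fun ℓ => by
  simp only [map_add]; exact (hF ℓ).add (hG ℓ)

theorem IsSmoothVec.map {F : X → V} (hF : IsSmoothVec F) (T : V →ₗ[ℝ] W) :
    IsSmoothVec (fun x => T (F x)) := fun ℓ => hF (ℓ ∘ₗ T)

theorem IsSmoothVec.sub {F G : X → V} (hF : IsSmoothVec F) (hG : IsSmoothVec G) :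
    IsSmoothVec (fun x => F x - G x) := by
  simpa [sub_eq_add_neg] using hF.add (hG.map (-LinearMap.id))

theorem IsSmoothVec.sum {ι : Type*} (s : Finset ι) {F : ι → X → V}
    (hF : ∀ i ∈ s, IsSmoothVec (F i)) : IsSmoothVec (fun x => ∑ i ∈ s, F i x) := fun ℓ => by
  simp only [map_sum]
  exact IsSmoothFun.sum s fun i hi => hF i hi ℓ

theorem IsSmoothFun.isSmoothVec_smul {r : X → ℝ} (hr : IsSmoothFun r) (v : V) :
    IsSmoothVec (fun x => r x • v) := fun ℓ => by
  simp only [map_smul, smul_eq_mul]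
  exact hr.mul (isSmoothFun_const _)

theorem isSmoothVec_pi {ι : Type*} [Fintype ι] {F : X → ι → V}
    (hF : ∀ i, IsSmoothVec fun x => F x i) : IsSmoothVec F := by
  classical
  have : F = fun x => ∑ i, LinearMap.single ℝ (fun _ => V) i (F x i) := by
    ext x j
    simp [Finset.sum_apply, Pi.single_apply]
  rw [this]
  exact IsSmoothVec.sum _ fun i _ => (hF i).map _

end Vec

variable {A : Type*} [CommRing A] [Algebra ℝ A]

theorem IsSmoothVec.mul [Module.Finite ℝ A] {F G : X → A} (hF : IsSmoothVec F)
    (hG : IsSmoothVec G) : IsSmoothVec (fun x => F x * G x) := by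
  let e := Module.finBasis ℝ A
  have h : (fun x => F x * G x) = fun x =>
      ∑ i, ∑ j, (e.coord i (F x) * e.coord j (G x)) • (e i * e j) := by
    ext x
    conv_lhs => rw [← e.sum_repr (F x), ← e.sum_repr (G x), Finset.sum_mul_sum]
    refine Finset.sum_congr rfl fun i _ => Finset.sum_congr rfl fun j _ => ?_
    rw [smul_mul_smul_comm]
    rfl
  rw [h]
  exact IsSmoothVec.sum _ fun i _ => IsSmoothVec.sum _ fun j _ =>
    ((hF _).mul (hG _)).isSmoothVec_smul _

/-- Each term is polynomial in the increments, with coefficients given by `ε` on iterated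
derivatives of `f`; this makes the local sections smooth. -/
theorem isSmoothVec_taylorTerm [Module.Finite ℝ A] {S : Type*} [CommRing S] [Algebra ℝ S] {n : ℕ}
    (D : Fin n → Derivation ℝ S S) {ε : X → S →ₐ[ℝ] ℝ} {ν : X → Fin n → A}
    (hε : ∀ f, IsSmoothFun fun x => ε x f) (hν : ∀ i, IsSmoothVec fun x => ν x i) (k : ℕ) :
    ∀ f, IsSmoothVec fun x => WeilAlgebra.taylorTerm D (ε x) (ν x) k f := by
  induction k with
  | zero =>
    intro f
    simp only [WeilAlgebra.taylorTerm_zero, Algebra.algebraMap_eq_smul_one]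
    exact (hε f).isSmoothVec_smul 1
  | succ k ih =>
    intro f
    simp only [WeilAlgebra.taylorTerm_succ]
    have h := IsSmoothVec.sum (X := X) Finset.univ
      (F := fun i x => ν x i * WeilAlgebra.taylorTerm D (ε x) (ν x) k (D i f))
      fun i _ => (hν i).mul (ih _)
    exact h.map (((k + 1 : ℝ)⁻¹) • (LinearMap.id : A →ₗ[ℝ] A))

end SmoothSpace

/-! ### Residue field, lifting from `A/I`, and detection of non-surjectivity -/

namespace WeilAlgebra

variable {A : Type*} [CommRing A] [Algebra ℝ A] {N : ℕ}
variable {S : Type*} [CommRing S] [Algebra ℝ S] {n : ℕ}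

/-- A finite local real algebra onto which an algebra of functions maps has residue field `ℝ`. -/
theorem exists_algHom_real [Module.Finite ℝ A] [IsLocalRing A] (p : S →ₐ[ℝ] A)
    (hp : Function.Surjective p) (hS : ∀ f : S, IsUnit (f ^ 2 + 1)) : Nonempty (A →ₐ[ℝ] ℝ) := by
  let π : A →ₐ[ℝ] IsLocalRing.ResidueField A := IsScalarTower.toAlgHom ℝ A _
  have hπ : Function.Surjective π := IsLocalRing.residue_surjective
  have : Module.Finite ℝ (IsLocalRing.ResidueField A) :=
    Module.Finite.of_surjective π.toLinearMap hπ
  rcases Real.nonempty_algEquiv_or (IsLocalRing.ResidueField A) with ⟨⟨e⟩⟩ | ⟨⟨e⟩⟩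
  · exact ⟨(e : _ →ₐ[ℝ] ℝ).comp π⟩
  · exfalso
    -- If the residue field were `ℂ`, a preimage `f` of the imaginary unit would send the invertible
    -- `f ^ 2 + 1` to zero.
    obtain ⟨a, ha⟩ := hπ (e.symm Complex.I)
    obtain ⟨f, rfl⟩ := hp a
    have h := (((hS f).map p).map π).map e
    have h0 : e (π (p (f ^ 2 + 1))) = 0 := by simp [ha]
    rw [h0] at h
    exact not_isUnit_zero h

theorem ker_eq_maximalIdeal [IsLocalRing A] (ρ : A →ₐ[ℝ] ℝ) :
    RingHom.ker ρ = IsLocalRing.maximalIdeal A :=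
  IsLocalRing.eq_maximalIdeal (RingHom.ker_isMaximal_of_surjective ρ.toRingHom fun r =>
    ⟨algebraMap ℝ A r, by simp⟩)

theorem exists_ker_pow_eq_bot [Module.Finite ℝ A] [IsLocalRing A] (ρ : A →ₐ[ℝ] ℝ) :
    ∃ N, RingHom.ker ρ ^ N = ⊥ := by
  have : IsArtinianRing A := IsArtinianRing.of_finite ℝ A
  rw [ker_eq_maximalIdeal, ← IsLocalRing.jacobson_eq_maximalIdeal ⊥ bot_ne_top]
  exact IsArtinianRing.isNilpotent_jacobson_bot

variable {ρ : A →ₐ[ℝ] ℝ} {I : Ideal A}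

/-- The residue map of the quotient. -/
noncomputable def quotResidue (hI : I ≤ RingHom.ker ρ) : A ⧸ I →ₐ[ℝ] ℝ :=
  Ideal.Quotient.liftₐ I ρ hI

theorem quotResidue_mk (hI : I ≤ RingHom.ker ρ) (a : A) :
    quotResidue hI (Ideal.Quotient.mk I a) = ρ a := rfl

theorem quotResidue_comp (hI : I ≤ RingHom.ker ρ) :
    (quotResidue hI).comp (Ideal.Quotient.mkₐ ℝ I) = ρ := rfl

theorem ker_quotResidue_pow (hI : I ≤ RingHom.ker ρ) (hN : RingHom.ker ρ ^ N = ⊥) :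
    RingHom.ker (quotResidue hI) ^ N = ⊥ := by
  have h : RingHom.ker (quotResidue hI) = (RingHom.ker ρ).map (Ideal.Quotient.mk I) :=
    Ideal.ker_quotient_lift (I := I) ρ.toRingHom hI
  rw [h, ← Ideal.map_pow, hN, Ideal.map_bot]

theorem exists_linear_section (I : Ideal A) :
    ∃ σ : A ⧸ I →ₗ[ℝ] A, ∀ b, Ideal.Quotient.mk I (σ b) = b := by
  obtain ⟨σ, hσ⟩ := (Ideal.Quotient.mkₐ ℝ I).toLinearMap.exists_rightInverse_of_surjective
    (LinearMap.range_eq_top.2 (Ideal.Quotient.mkₐ_surjective ℝ I))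
  exact ⟨σ, fun b => LinearMap.congr_fun hσ b⟩

section Lift

variable (hI : I ≤ RingHom.ker ρ) {σ : A ⧸ I →ₗ[ℝ] A} (hσ : ∀ b, Ideal.Quotient.mk I (σ b) = b)

/-- The increments of the lift of a morphism along a linear section. -/
noncomputable def liftIncrement (hI : I ≤ RingHom.ker ρ) (σ : A ⧸ I →ₗ[ℝ] A) (F : LocalFrame S n)
    (b : S →ₐ[ℝ] A ⧸ I) (i : Fin n) : A :=
  σ (b (F.x i) - algebraMap ℝ _ (quotResidue hI (b (F.x i))))

theorem liftIncrement_mem (hσ : ∀ b, Ideal.Quotient.mk I (σ b) = b) (F : LocalFrame S n) (b : S →ₐ[ℝ] A ⧸ I) (i : Fin n) :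
    liftIncrement hI σ F b i ∈ RingHom.ker ρ := by
  rw [RingHom.mem_ker, ← quotResidue_mk hI, liftIncrement, hσ]
  simp

/-- The lift of a morphism to the quotient, along a linear section. -/
noncomputable def liftHom (hN : RingHom.ker ρ ^ N = ⊥) (F : LocalFrame S n)
    (b : S →ₐ[ℝ] A ⧸ I) : S →ₐ[ℝ] A :=
  taylorHom F.X ((quotResidue hI).comp b) (liftIncrement hI σ F b) hN (liftIncrement_mem hI hσ F b)

/-- Both morphisms into `A/I` have the same residue and the same coordinates, since `σ` is a
section. -/
theorem mk_comp_liftHom (hN : RingHom.ker ρ ^ N = ⊥) (F : LocalFrame S n) (b : S →ₐ[ℝ] A ⧸ I)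
    (hχ : quotResidue hI (b F.χ) ≠ 0) :
    (Ideal.Quotient.mkₐ ℝ I).comp (liftHom hI hσ hN F b) = b := by
  have h : (quotResidue hI).comp ((Ideal.Quotient.mkₐ ℝ I).comp (liftHom hI hσ hN F b)) =
      (quotResidue hI).comp b := by
    rw [← AlgHom.comp_assoc, quotResidue_comp]
    exact comp_taylorHom hN _
  refine algHom_ext (ker_quotResidue_pow hI hN) F _ _ h ?_ fun i => ?_
  · have := AlgHom.congr_fun h F.χ
    rw [AlgHom.comp_apply] at this
    rwa [this]
  · rw [AlgHom.comp_apply, liftHom, taylorHom_coord F hχ, map_add, AlgHom.commutes]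
    have : Ideal.Quotient.mkₐ ℝ I (liftIncrement hI σ F b i) = _ := hσ _
    rw [this, AlgHom.comp_apply]
    ring

theorem surjective_liftHom (hN : RingHom.ker ρ ^ N = ⊥) (hI2 : I ≤ RingHom.ker ρ ^ 2)
    (F : LocalFrame S n) (b : S →ₐ[ℝ] A ⧸ I) (hχ : quotResidue hI (b F.χ) ≠ 0)
    (hb : Function.Surjective b) : Function.Surjective (liftHom hI hσ hN F b) := by
  refine surjective_of_surjective_mod hN hI2 _ ?_
  rwa [mk_comp_liftHom hI hσ hN F b hχ]

end Lift

theorem surjective_addDer (hN : RingHom.ker ρ ^ N = ⊥) (hI2 : I ≤ RingHom.ker ρ ^ 2)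
    (p : S →ₐ[ℝ] A) (hp : Function.Surjective p) (D : S →ₗ[ℝ] A)
    (hD : ∀ f g, D (f * g) = p f * D g + p g * D f) (h0 : ∀ f g, D f * D g = 0)
    (hDI : ∀ f, D f ∈ I) : Function.Surjective (addDer p D hD h0) := by
  refine surjective_of_surjective_mod hN hI2 _ fun b => ?_
  obtain ⟨f, rfl⟩ := (Ideal.Quotient.mkₐ_surjective ℝ I).comp hp b
  refine ⟨f, Ideal.Quotient.eq.2 ?_⟩
  have h : addDer p D hD h0 f - p f = D f := by rw [addDer_apply, add_sub_cancel_left]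
  exact h ▸ hDI f

/-- A vector outside the square of the maximal ideal is detected by a linear form that vanishes on
this square and on the constants. -/
theorem exists_linearForm {v : A} (hv : v ∈ RingHom.ker ρ) (hv' : v ∉ RingHom.ker ρ ^ 2) :
    ∃ Λ : A →ₗ[ℝ] ℝ, Λ 1 = 0 ∧ (∀ a ∈ RingHom.ker ρ ^ 2, Λ a = 0) ∧ Λ v = 1 := by
  let W : Submodule ℝ A := (ℝ ∙ (1 : A)) ⊔ (RingHom.ker ρ ^ 2).restrictScalars ℝ
  have hW : v ∉ W := by
    intro h
    obtain ⟨y, hy, z, hz, e⟩ := Submodule.mem_sup.1 h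
    obtain ⟨r, rfl⟩ := Submodule.mem_span_singleton.1 hy
    have hz' : ρ z = 0 := Ideal.pow_le_self two_ne_zero hz
    have h1 := congrArg ρ e
    rw [map_add, map_smul, map_one, hz', add_zero, RingHom.mem_ker.1 hv, smul_eq_mul, mul_one] at h1
    rw [h1, zero_smul, zero_add] at e
    exact hv' (e ▸ hz)
  obtain ⟨Λ, hΛv, hΛ⟩ := Submodule.exists_le_ker_of_notMem hW
  refine ⟨(Λ v)⁻¹ • Λ, ?_, fun a ha => ?_, ?_⟩
  · have : Λ 1 = 0 := hΛ (Submodule.mem_sup_left (Submodule.mem_span_singleton_self 1))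
    simp [this]
  · have : Λ a = 0 := hΛ (Submodule.mem_sup_right ha)
    simp [this]
  · simp [hΛv]

/-- Since `Λ v = 1`, the correction puts every `q (x i)` in `ker Λ`. The whole image follows, and
`v` is missed. -/
theorem not_surjective_of_linearForm (hN : RingHom.ker ρ ^ N = ⊥) (F : LocalFrame S n)
    {Λ : A →ₗ[ℝ] ℝ} (h1 : Λ 1 = 0) (h2 : ∀ a ∈ RingHom.ker ρ ^ 2, Λ a = 0) {v : A} (hv : Λ v = 1)
    (p q : S →ₐ[ℝ] A) (hχ : ρ (q F.χ) ≠ 0)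
    (hx : ∀ i, q (F.x i) = p (F.x i) - Λ (p (F.x i)) • v) : ¬ Function.Surjective q := by
  intro hq
  obtain ⟨f, rfl⟩ := hq v
  have := linearForm_comp_eq_zero hN F q hχ Λ h1 h2 (fun i => by simp [hx, hv]) f
  rw [this] at hv
  exact zero_ne_one hv

/-- Without coordinates Hadamard's expansion is just the constant, so `p` has only real values. -/
theorem ker_eq_bot_of_frame_zero (hN : RingHom.ker ρ ^ N = ⊥) (F : LocalFrame S 0)
    (p : S →ₐ[ℝ] A) (hp : Function.Surjective p) (hχ : ρ (p F.χ) ≠ 0) : RingHom.ker ρ = ⊥ := by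
  refine (Submodule.eq_bot_iff _).2 fun a ha => ?_
  obtain ⟨f, rfl⟩ := hp a
  obtain ⟨g, h, hh, e⟩ := F.hadamard (ρ.comp p) hχ f
  have := map_eq_zero_of_mul_eq_zero hN p hh e
  have ha' : ρ (p f) = 0 := ha
  simpa [ha'] using this

end WeilAlgebra

/-! ### Fibres of the projection between regular points -/

section NearPoints

open SmoothSpace WeilAlgebra

variable {n : ℕ} {M : Type*} [TopologicalSpace M] [ChartedSpace (EuclideanSpace ℝ (Fin n)) M]
variable {A : Type*} [CommRing A] [Algebra ℝ A] {ρ : A →ₐ[ℝ] ℝ} {N : ℕ} {I : Ideal A}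

theorem RegPoint.ext {p q : RegPoint n M A} (h : ∀ f, p.1.val f = q.1.val f) : p = q :=
  Subtype.ext (AlgHom.ext h)

theorem regTrans_eq_iff {p q : RegPoint n M A} :
    regTrans I p = regTrans I q ↔ ∀ f, p.1.val f - q.1.val f ∈ I := by
  constructor
  · intro h f
    have : (regTrans I p).1.val f = (regTrans I q).1.val f := by rw [h]
    exact Ideal.Quotient.eq.1 this
  · exact fun h => RegPoint.ext fun f => Ideal.Quotient.eq.2 (h f)

/-- Changing `p` to `q` alters the Leibniz rule by products `(p f - q f) * D g` of two elements of
`I`. -/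
theorem vertDer_le_of_regTrans_eq (hann : ∀ a ∈ I, ∀ b ∈ I, a * b = 0) {p q : RegPoint n M A}
    (h : regTrans I p = regTrans I q) : vertDer I p.1 ≤ vertDer I q.1 := by
  rintro D ⟨hD, hDI⟩
  refine ⟨fun f g => ?_, hDI⟩
  have h' := regTrans_eq_iff.1 h
  rw [hD]
  linear_combination hann _ (h' f) _ (hDI g) + hann _ (h' g) _ (hDI f)

theorem mem_modelFibre_iff (hann : ∀ a ∈ I, ∀ b ∈ I, a * b = 0) {b : RegPoint n M (A ⧸ I)}
    {p : RegPoint n M A} (hp : regTrans I p = b) (D : SmoothFun n M →ₗ[ℝ] A) :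
    D ∈ modelFibre I b ↔ D ∈ vertDer I p.1 := by
  simp only [modelFibre, Submodule.mem_iInf]
  exact ⟨fun h => h p hp, fun h q hq => vertDer_le_of_regTrans_eq hann (hp.trans hq.symm) h⟩

theorem frameDer_mem_vertDer (F : LocalFrame (SmoothFun n M) n) (p : NearPoint n M A)
    {v : Fin n → A} (hv : ∀ i, v i ∈ I) : frameDer F p.val v ∈ vertDer I p :=
  ⟨frameDer_mul F p.val v, fun f => by
    rw [frameDer_apply]
    exact Ideal.sum_mem _ fun i _ => I.mul_mem_left _ (hv i)⟩

/-- The translate of a regular point by a vertical vector. -/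
noncomputable def RegPoint.translate (hN : RingHom.ker ρ ^ N = ⊥) (hI2 : I ≤ RingHom.ker ρ ^ 2)
    (hann : ∀ a ∈ I, ∀ b ∈ I, a * b = 0) (p : RegPoint n M A) (D : SmoothFun n M →ₗ[ℝ] A)
    (hD : D ∈ vertDer I p.1) : RegPoint n M A :=
  ⟨addDer p.1.val D hD.1 fun f g => hann _ (hD.2 f) _ (hD.2 g),
    surjective_addDer hN hI2 _ p.2 D _ _ hD.2⟩

section Translate

variable (hN : RingHom.ker ρ ^ N = ⊥) (hI2 : I ≤ RingHom.ker ρ ^ 2)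
  (hann : ∀ a ∈ I, ∀ b ∈ I, a * b = 0) (p : RegPoint n M A) (D : SmoothFun n M →ₗ[ℝ] A)
  (hD : D ∈ vertDer I p.1)

theorem RegPoint.translate_val (f : SmoothFun n M) :
    (p.translate hN hI2 hann D hD).1.val f = p.1.val f + D f := rfl

theorem RegPoint.regTrans_translate :
    regTrans I (p.translate hN hI2 hann D hD) = regTrans I p :=
  regTrans_eq_iff.2 fun f => by
    rw [RegPoint.translate_val, add_sub_cancel_left]
    exact hD.2 f

end Translate

/-- The defect of `q - p` from being a derivation over `p` is `(q - p) f * (q - p) g`, which lies in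
`I * I = 0`. -/
theorem exists_vertDer_of_regTrans_eq (hann : ∀ a ∈ I, ∀ b ∈ I, a * b = 0)
    {p q : RegPoint n M A} (h : regTrans I q = regTrans I p) :
    ∃ D ∈ vertDer I p.1, ∀ f, q.1.val f = p.1.val f + D f := by
  have h' := regTrans_eq_iff.1 h
  refine ⟨q.1.val.toLinearMap - p.1.val.toLinearMap, ⟨fun f g => ?_, h'⟩, fun f => ?_⟩
  · simp only [LinearMap.sub_apply, AlgHom.toLinearMap_apply, map_mul]
    linear_combination hann _ (h' f) _ (h' g)
  · simp

variable [IsManifold (𝓡 n) ∞ M] [T2Space M] [SecondCountableTopology M]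

theorem regTrans_surjective (hN : RingHom.ker ρ ^ N = ⊥) (hI2 : I ≤ RingHom.ker ρ ^ 2) :
    Function.Surjective (regTrans I : RegPoint n M A → RegPoint n M (A ⧸ I)) := by
  intro b
  have hI : I ≤ RingHom.ker ρ := hI2.trans (Ideal.pow_le_self two_ne_zero)
  obtain ⟨σ, hσ⟩ := exists_linear_section I
  obtain ⟨F, hF⟩ := exists_localFrame ((quotResidue hI).comp b.1.val)
  exact ⟨⟨liftHom hI hσ hN F b.1.val, surjective_liftHom hI hσ hN hI2 F b.1.val hF b.2⟩,
    Subtype.ext (mk_comp_liftHom hI hσ hN F b.1.val hF)⟩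

end NearPoints

/-! ### Local trivializations over the domain of a frame -/

section NearPoints

open SmoothSpace WeilAlgebra

variable {n : ℕ} {M : Type*} [TopologicalSpace M] [ChartedSpace (EuclideanSpace ℝ (Fin n)) M]
variable {A : Type*} [CommRing A] [Algebra ℝ A] {ρ : A →ₐ[ℝ] ℝ} {N : ℕ} {I : Ideal A}

theorem isOpen_preimage_coord {X : Type*} [SmoothSpace X] {c : X → ℝ} (hc : c ∈ coord (X := X))
    {s : Set ℝ} (hs : IsOpen s) : IsOpen[topology X] (c ⁻¹' s) := by
  have h : topology X ≤ TopologicalSpace.induced c inferInstance := iInf₂_le c hc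
  exact h _ ⟨s, hs, rfl⟩

/-- The regular points lying over the domain of a frame. -/
def frameDomain (hI : I ≤ RingHom.ker ρ) (F : LocalFrame (SmoothFun n M) n) :
    Set (RegPoint n M (A ⧸ I)) :=
  {b | quotResidue hI (b.1.val F.χ) ≠ 0}

theorem isOpen_frameDomain (hI : I ≤ RingHom.ker ρ) (F : LocalFrame (SmoothFun n M) n) :
    IsOpen[topology (RegPoint n M (A ⧸ I))] (frameDomain hI F) := by
  have hc : (fun b : RegPoint n M (A ⧸ I) => (quotResidue hI).toLinearMap (b.1.val F.χ)) ∈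
      coord (X := RegPoint n M (A ⧸ I)) := ⟨_, ⟨F.χ, (quotResidue hI).toLinearMap, rfl⟩, rfl⟩
  exact isOpen_preimage_coord hc (isOpen_compl_singleton (x := (0 : ℝ)))

section Section

variable (hI : I ≤ RingHom.ker ρ) {σ : A ⧸ I →ₗ[ℝ] A} (hσ : ∀ b, Ideal.Quotient.mk I (σ b) = b)
  (hN : RingHom.ker ρ ^ N = ⊥) (hI2 : I ≤ RingHom.ker ρ ^ 2)
  (hann : ∀ a ∈ I, ∀ b ∈ I, a * b = 0)
  (F : LocalFrame (SmoothFun n M) n) (u : frameDomain hI F)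

/-- The section of the projection over the domain of a frame. -/
noncomputable def frameSection : RegPoint n M A :=
  ⟨liftHom hI hσ hN F u.1.1.val, surjective_liftHom hI hσ hN hI2 F u.1.1.val u.2 u.1.2⟩

theorem regTrans_frameSection : regTrans I (frameSection hI hσ hN hI2 F u) = u.1 :=
  Subtype.ext (mk_comp_liftHom hI hσ hN F u.1.1.val u.2)

theorem residue_eq_of_regTrans_mem {p : RegPoint n M A} (hp : regTrans I p ∈ frameDomain hI F) :
    ρ (p.1.val F.χ) ≠ 0 := hp

theorem residue_frameSection : ρ ((frameSection hI hσ hN hI2 F u).1.val F.χ) ≠ 0 := by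
  refine residue_eq_of_regTrans_mem hI F ?_
  rw [regTrans_frameSection]
  exact u.2

theorem frameSection_val (f : SmoothFun n M) : (frameSection hI hσ hN hI2 F u).1.val f =
    ∑ k ∈ Finset.range (N + 1), taylorTerm F.X ((quotResidue hI).comp u.1.1.val)
      (liftIncrement hI σ F u.1.1.val) k f :=
  taylorHom_apply hN (liftIncrement_mem hI hσ F u.1.1.val) f

theorem isSmoothVec_frameSection [Module.Finite ℝ A] {X : Type*} [SmoothSpace X]
    {t : X → frameDomain hI F} (ht : ∀ f, IsSmoothVec fun x => (t x).1.1.val f)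
    (f : SmoothFun n M) :
    IsSmoothVec fun x => (frameSection hI hσ hN hI2 F (t x)).1.val f := by
  simp only [frameSection_val]
  have hε : ∀ f, IsSmoothFun fun x => (quotResidue hI).comp (t x).1.1.val f :=
    fun f => ht f (quotResidue hI).toLinearMap
  refine IsSmoothVec.sum _ fun k _ => isSmoothVec_taylorTerm F.X hε (fun i => ?_) k f
  simp only [liftIncrement, Algebra.algebraMap_eq_smul_one]
  exact ((ht _).sub ((hε _).isSmoothVec_smul 1)).map σ

/-- Vertical vectors over the domain of a frame correspond to their components. -/
noncomputable def frameLinear : (Fin n → I) ≃ₗ[ℝ] modelFibre I u.1 :=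
  LinearEquiv.ofBijective
    { toFun := fun v => ⟨frameDer F (frameSection hI hσ hN hI2 F u).1.val fun i => v i,
        (mem_modelFibre_iff hann (regTrans_frameSection hI hσ hN hI2 F u) _).2
          (frameDer_mem_vertDer F _ fun i => (v i).2)⟩
      map_add' := fun v w => by
        ext f
        simp [frameDer_apply, mul_add, Finset.sum_add_distrib]
      map_smul' := fun r v => by
        ext f
        simp [frameDer_apply, Finset.smul_sum] }
    (by
      have hχ := residue_frameSection hI hσ hN hI2 F u
      constructor
      · intro v w h
        ext j
        have := LinearMap.congr_fun (Subtype.ext_iff.1 h) (F.x j)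
        simpa [frameDer_coord hN F _ hχ] using this
      · rintro ⟨D, hD⟩
        have hD' := (mem_modelFibre_iff hann (regTrans_frameSection hI hσ hN hI2 F u) _).1 hD
        refine ⟨fun i => ⟨D (F.x i), hD'.2 _⟩, Subtype.ext ?_⟩
        exact derivation_ext hN F _ hχ _ _ (frameDer_mul F _ _) hD'.1
          fun i => frameDer_coord hN F _ hχ _ i)

theorem frameLinear_apply (v : Fin n → I) (f : SmoothFun n M) :
    (frameLinear hI hσ hN hI2 hann F u v).1 f =
      ∑ i, (frameSection hI hσ hN hI2 F u).1.val (F.X i f) * v i :=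
  frameDer_apply F _ _ f

theorem frameLinear_coord (v : Fin n → I) (j : Fin n) :
    (frameLinear hI hσ hN hI2 hann F u v).1 (F.x j) = v j :=
  frameDer_coord hN F _ (residue_frameSection hI hσ hN hI2 F u) _ j

theorem frameLinear_symm_coord (D : modelFibre I u.1) (j : Fin n) :
    (((frameLinear hI hσ hN hI2 hann F u).symm D j : I) : A) = D.1 (F.x j) := by
  rw [← frameLinear_coord hI hσ hN hI2 hann F u, LinearEquiv.apply_symm_apply]

theorem frameLinear_mem_vertDer (v : Fin n → I) : (frameLinear hI hσ hN hI2 hann F u v).1 ∈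
    vertDer I (frameSection hI hσ hN hI2 F u).1 :=
  (mem_modelFibre_iff hann (regTrans_frameSection hI hσ hN hI2 F u) _).1
    (frameLinear hI hσ hN hI2 hann F u v).2

/-- The point of the fibre with given components relative to the section. -/
noncomputable def framePoint (v : Fin n → I) : RegPoint n M A :=
  (frameSection hI hσ hN hI2 F u).translate hN hI2 hann (frameLinear hI hσ hN hI2 hann F u v).1
    (frameLinear_mem_vertDer hI hσ hN hI2 hann F u v)

theorem framePoint_val (v : Fin n → I) (f : SmoothFun n M) :
    (framePoint hI hσ hN hI2 hann F u v).1.val f =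
      (frameSection hI hσ hN hI2 F u).1.val f + (frameLinear hI hσ hN hI2 hann F u v).1 f := rfl

theorem regTrans_framePoint (v : Fin n → I) :
    regTrans I (framePoint hI hσ hN hI2 hann F u v) = u.1 :=
  (RegPoint.regTrans_translate hN hI2 hann _ _ _).trans (regTrans_frameSection hI hσ hN hI2 F u)

/-- The components of a regular point relative to the section. -/
noncomputable def frameComponents
    (p : {p : RegPoint n M A // regTrans I p ∈ frameDomain hI F}) : Fin n → I := fun i =>
  ⟨p.1.1.val (F.x i) - (frameSection hI hσ hN hI2 F ⟨regTrans I p.1, p.2⟩).1.val (F.x i),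
    regTrans_eq_iff.1 (regTrans_frameSection hI hσ hN hI2 F ⟨regTrans I p.1, p.2⟩).symm _⟩

/-- The trivialization over the domain of a frame. -/
noncomputable def frameTriv : frameDomain hI F × (Fin n → I) ≃
    {p : RegPoint n M A // regTrans I p ∈ frameDomain hI F} where
  toFun x := ⟨framePoint hI hσ hN hI2 hann F x.1 x.2, by
    rw [regTrans_framePoint]
    exact x.1.2⟩
  invFun p := (⟨regTrans I p.1, p.2⟩, frameComponents hI hσ hN hI2 F p)
  left_inv := by
    rintro ⟨u, v⟩
    have hu : (⟨regTrans I (framePoint hI hσ hN hI2 hann F u v), by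
        rw [regTrans_framePoint]; exact u.2⟩ : frameDomain hI F) = u :=
      Subtype.ext (regTrans_framePoint hI hσ hN hI2 hann F u v)
    refine Prod.ext hu (funext fun i => Subtype.ext ?_)
    change (framePoint hI hσ hN hI2 hann F u v).1.val (F.x i) -
      (frameSection hI hσ hN hI2 F ⟨_, _⟩).1.val (F.x i) = v i
    rw [hu, framePoint_val, frameLinear_coord, add_sub_cancel_left]
  right_inv := by
    intro p
    set u : frameDomain hI F := ⟨regTrans I p.1, p.2⟩ with hu
    have h1 := regTrans_framePoint hI hσ hN hI2 hann F u (frameComponents hI hσ hN hI2 F p)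
    refine Subtype.ext (Subtype.ext ?_)
    have h2 : ρ.comp (framePoint hI hσ hN hI2 hann F u
        (frameComponents hI hσ hN hI2 F p)).1.val = ρ.comp p.1.1.val := by
      ext f
      have h3 := regTrans_eq_iff.1 h1 f
      have h4 := hI h3
      rwa [RingHom.mem_ker, map_sub, sub_eq_zero] at h4
    refine algHom_ext hN F _ _ h2 ?_ fun i => ?_
    · refine residue_eq_of_regTrans_mem hI F ?_
      rw [h1]
      exact u.2
    · have h3 := framePoint_val hI hσ hN hI2 hann F u (frameComponents hI hσ hN hI2 F p) (F.x i)
      rw [frameLinear_coord] at h3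
      exact h3.trans (add_sub_cancel _ _)

theorem isSmoothVec_frameLinear [Module.Finite ℝ A] {X : Type*} [SmoothSpace X]
    {t : X → frameDomain hI F} (ht : ∀ f, IsSmoothVec fun x => (t x).1.1.val f)
    {v : X → Fin n → I} (hv : ∀ i, IsSmoothVec fun x => (v x i : A)) (f : SmoothFun n M) :
    IsSmoothVec fun x => (frameLinear hI hσ hN hI2 hann F (t x) (v x)).1 f := by
  simp only [frameLinear_apply]
  exact IsSmoothVec.sum _ fun i _ =>
    (isSmoothVec_frameSection hI hσ hN hI2 F ht _).mul (hv i)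

end Section

/-- Linear forms on `I` extend to `A`, through a linear retraction. -/
theorem isSmoothVec_ideal {X : Type*} [SmoothSpace X] {v : X → I}
    (hv : IsSmoothVec fun x => (v x : A)) : IsSmoothVec v := by
  obtain ⟨g, hg⟩ := (I.subtype.restrictScalars ℝ).exists_leftInverse_of_injective
    (LinearMap.ker_eq_bot.2 Subtype.val_injective)
  have h : v = fun x => g (v x : A) := funext fun x => (LinearMap.congr_fun hg (v x)).symm
  rw [h]
  exact hv.map g

theorem isSmoothVec_coordinates {X : Type*} [SmoothSpace X] {k : ℕ} {v : X → Fin k → ℝ}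
    (hv : ∀ j, IsSmoothFun fun x => v x j) : IsSmoothVec v :=
  isSmoothVec_pi fun j => by simpa using (hv j).isSmoothVec_smul (1 : ℝ)

variable [IsManifold (𝓡 n) ∞ M] [T2Space M] [SecondCountableTopology M]

theorem isCanonicalAffineBundle [Module.Finite ℝ A] (hN : RingHom.ker ρ ^ N = ⊥)
    (hI2 : I ≤ RingHom.ker ρ ^ 2) (hann : ∀ a ∈ I, ∀ b ∈ I, a * b = 0) :
    IsCanonicalAffineBundle n M I where
  surjective := regTrans_surjective hN hI2
  vertDer_eq p q h := le_antisymm (vertDer_le_of_regTrans_eq hann h)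
    (vertDer_le_of_regTrans_eq hann h.symm)
  add_mem p D hD := ⟨p.translate hN hI2 hann D hD,
    RegPoint.regTrans_translate hN hI2 hann p D hD, fun _ => rfl⟩
  sub_mem p q h := exists_vertDer_of_regTrans_eq hann h
  locally_trivial b := by
    have hI : I ≤ RingHom.ker ρ := hI2.trans (Ideal.pow_le_self two_ne_zero)
    obtain ⟨σ, hσ⟩ := exists_linear_section I
    obtain ⟨F, hF⟩ := exists_localFrame ((quotResidue hI).comp b.1.val)
    have : Module.Finite ℝ I := Module.Finite.of_injective (I.subtype.restrictScalars ℝ)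
      Subtype.val_injective
    let β : (Fin n → I) ≃ₗ[ℝ] (Fin (Module.finrank ℝ (Fin n → I)) → ℝ) :=
      (Module.finBasis ℝ (Fin n → I)).equivFun
    have hβ : ∀ {X : Type _} [SmoothSpace X] {v : X → Fin n → I},
        (∀ i, IsSmoothVec fun x => (v x i : A)) → ∀ j, IsSmoothFun fun x => β (v x) j :=
      fun hv j => (isSmoothVec_pi fun i => isSmoothVec_ideal (hv i))
        (LinearMap.proj j ∘ₗ β.toLinearMap)
    have hβ' : ∀ i, IsSmoothVec
        fun x : frameDomain hI F × (Fin (Module.finrank ℝ (Fin n → I)) → ℝ) =>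
          (β.symm x.2 i : A) := fun i =>
      (isSmoothVec_coordinates fun j =>
        isSmoothFun_of_mem (Or.inr ⟨_, ⟨j, rfl⟩, rfl⟩)).map
          (I.subtype.restrictScalars ℝ ∘ₗ LinearMap.proj i ∘ₗ β.symm.toLinearMap)
    have hbase : ∀ f, IsSmoothVec
        fun x : frameDomain hI F × (Fin (Module.finrank ℝ (Fin n → I)) → ℝ) =>
          x.1.1.1.val f := fun f ℓ =>
      isSmoothFun_of_mem (Or.inl ⟨_, ⟨_, ⟨_, ⟨f, ℓ, rfl⟩, rfl⟩, rfl⟩, rfl⟩)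
    refine ⟨frameDomain hI F, isOpen_frameDomain hI F, hF, Module.finrank ℝ (Fin n → I),
      ((Equiv.refl _).prodCongr β.symm.toEquiv).trans (frameTriv hI hσ hN hI2 hann F),
      fun u => β.symm.trans (frameLinear hI hσ hN hI2 hann F u), ?_, ?_, ?_, ?_, ?_, ?_⟩
    · intro x
      exact regTrans_framePoint hI hσ hN hI2 hann F x.1 (β.symm x.2)
    · rintro _ ⟨_, ⟨_, ⟨f, ℓ, rfl⟩, rfl⟩, rfl⟩
      exact ((isSmoothVec_frameSection hI hσ hN hI2 F hbase f).add
        (isSmoothVec_frameLinear hI hσ hN hI2 hann F hbase hβ' f)) ℓ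
    · have hpt : ∀ f, IsSmoothVec
          fun p : {p : RegPoint n M A // regTrans I p ∈ frameDomain hI F} => p.1.1.val f :=
        fun f ℓ => isSmoothFun_of_mem ⟨_, ⟨_, ⟨f, ℓ, rfl⟩, rfl⟩, rfl⟩
      have hpb : ∀ f, IsSmoothVec
          fun p : {p : RegPoint n M A // regTrans I p ∈ frameDomain hI F} =>
            (⟨regTrans I p.1, p.2⟩ : frameDomain hI F).1.1.val f :=
        fun f => (hpt f).map (Ideal.Quotient.mkₐ ℝ I).toLinearMap
      rintro _ (⟨_, ⟨_, ⟨_, ⟨f, ℓ, rfl⟩, rfl⟩, rfl⟩, rfl⟩ | ⟨_, ⟨j, rfl⟩, rfl⟩)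
      · exact hpb f ℓ
      · exact hβ (v := frameComponents hI hσ hN hI2 F)
          (fun i => (hpt _).sub (isSmoothVec_frameSection hI hσ hN hI2 F hpb _)) j
    · rintro _ (⟨_, ⟨_, ⟨f, ℓ, rfl⟩, rfl⟩, rfl⟩ | ⟨f, ℓ, rfl⟩)
      · exact hbase f ℓ
      · exact isSmoothVec_frameLinear hI hσ hN hI2 hann F hbase hβ' f ℓ
    · rintro _ ⟨j, rfl⟩
      refine hβ (v := fun t : {t : ModelBundle n M I // t.base ∈ frameDomain hI F} =>
        (frameLinear hI hσ hN hI2 hann F ⟨t.1.base, t.2⟩).symm t.1.vec) (fun i => ?_) j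
      refine fun ℓ => isSmoothFun_of_mem ⟨_, Or.inr ⟨F.x i, ℓ, rfl⟩, funext fun t => ?_⟩
      exact congrArg ℓ
        (frameLinear_symm_coord hI hσ hN hI2 hann F ⟨t.1.base, t.2⟩ t.1.vec i)
    · intro u v w f
      change (framePoint hI hσ hN hI2 hann F u (β.symm (v + w))).1.val f =
        (framePoint hI hσ hN hI2 hann F u (β.symm v)).1.val f +
        (frameLinear hI hσ hN hI2 hann F u (β.symm w)).1 f
      rw [framePoint_val, framePoint_val, map_add, map_add, add_assoc]
      rfl

/-! ### Necessity of the conditions -/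

/-- For `v ∈ I` outside `m²`, the vertical derivation with components `-Λ (p (x i)) • v` would
translate `p` to a point with image in `ker Λ`. -/
theorem ideal_le_sq_of_add_mem (hN : RingHom.ker ρ ^ N = ⊥) (hI : I ≤ RingHom.ker ρ)
    (p : RegPoint n M A)
    (h : ∀ D ∈ vertDer I p.1, ∃ q : RegPoint n M A, ∀ f, q.1.val f = p.1.val f + D f) :
    I ≤ RingHom.ker ρ ^ 2 := by
  obtain ⟨F, hF⟩ := exists_localFrame (ρ.comp p.1.val)
  intro v hv
  by_contra hv2
  obtain ⟨Λ, h1, h2, hΛv⟩ := exists_linearForm (hI hv) hv2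
  obtain ⟨q, hq⟩ := h _ (frameDer_mem_vertDer F p.1 (v := fun i => -Λ (p.1.val (F.x i)) • v)
    fun i => by rw [Algebra.smul_def]; exact I.mul_mem_left _ hv)
  refine not_surjective_of_linearForm hN F h1 h2 hΛv p.1.val q.1.val ?_ (fun i => ?_) q.2
  · have h3 : frameDer F p.1.val (fun i => -Λ (p.1.val (F.x i)) • v) F.χ ∈ I :=
      (frameDer_mem_vertDer F p.1 (v := fun i => -Λ (p.1.val (F.x i)) • v)
        fun i => by rw [Algebra.smul_def]; exact I.mul_mem_left _ hv).2 _
    rw [hq, map_add, RingHom.mem_ker.1 (hI h3), add_zero]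
    exact hF
  · rw [hq, frameDer_coord hN F _ hF, neg_smul, sub_eq_add_neg]

theorem mul_eq_zero_of_add_mem (hN : RingHom.ker ρ ^ N = ⊥) (hI : I ≤ RingHom.ker ρ)
    (p : RegPoint n M A)
    (h : ∀ D ∈ vertDer I p.1, ∃ q : RegPoint n M A, ∀ f, q.1.val f = p.1.val f + D f) :
    ∀ a ∈ I, ∀ b ∈ I, a * b = 0 := by
  obtain ⟨F, hF⟩ := exists_localFrame (ρ.comp p.1.val)
  -- In dimension zero there is no coordinate to test, but a regular point forces `m = 0`.
  rcases Nat.eq_zero_or_pos n with rfl | hn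
  · intro a ha b _
    have := hI ha
    rw [ker_eq_bot_of_frame_zero hN F p.1.val p.2 hF, Ideal.mem_bot] at this
    rw [this, zero_mul]
  · have hsq : ∀ a ∈ I, a * a = 0 := by
      intro a ha
      have hD := frameDer_mem_vertDer F p.1 (v := fun _ => a) fun _ => ha
      obtain ⟨q, hq⟩ := h _ hD
      -- Multiplicativity of `q` gives `(p x + a)²`, the derivation gives `(p x)² + 2 a p x`; the
      -- difference is `a²`.
      have h1 := hq (F.x ⟨0, hn⟩ * F.x ⟨0, hn⟩)
      rw [map_mul, hq, map_mul, frameDer_mul, frameDer_coord hN F _ hF] at h1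
      linear_combination h1
    intro a ha b hb
    have h2 : (2 : ℝ) • (a * b) = 0 := by
      rw [two_smul]
      linear_combination hsq _ (I.add_mem ha hb) - hsq a ha - hsq b hb
    exact (smul_eq_zero_iff_right (two_ne_zero)).1 h2

/-- The same displaced point as for translations, now built by Taylor expansion, since adding a
derivation need not give a morphism here. -/
theorem ideal_le_sq_of_isRegular (hN : RingHom.ker ρ ^ N = ⊥) (hI : I ≤ RingHom.ker ρ)
    (p : RegPoint n M A) (h : ∀ q : NearPoint n M A, (natTrans I q).IsRegular → q.IsRegular) :
    I ≤ RingHom.ker ρ ^ 2 := by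
  obtain ⟨F, hF⟩ := exists_localFrame (ρ.comp p.1.val)
  intro v hv
  by_contra hv2
  obtain ⟨Λ, h1, h2, hΛv⟩ := exists_linearForm (hI hv) hv2
  have hν : ∀ i, p.1.val (F.x i) - algebraMap ℝ A (ρ (p.1.val (F.x i))) -
      Λ (p.1.val (F.x i)) • v ∈ RingHom.ker ρ := fun i => by
    refine Ideal.sub_mem _ (sub_algebraMap_mem_ker ρ _) ?_
    rw [Algebra.smul_def]
    exact Ideal.mul_mem_left _ _ (hI hv)
  let q : SmoothFun n M →ₐ[ℝ] A := taylorHom F.X (ρ.comp p.1.val) _ hN hν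
  have hq : ρ.comp q = ρ.comp p.1.val := comp_taylorHom hN hν
  have hqχ : ρ (q F.χ) ≠ 0 := by
    have := AlgHom.congr_fun hq F.χ
    rw [AlgHom.comp_apply] at this
    rwa [this]
  have hqx : ∀ i, q (F.x i) = p.1.val (F.x i) - Λ (p.1.val (F.x i)) • v := fun i => by
    rw [taylorHom_coord F hF, AlgHom.comp_apply]
    ring
  refine not_surjective_of_linearForm hN F h1 h2 hΛv p.1.val q hqχ hqx (h q ?_)
  have hpq : (Ideal.Quotient.mkₐ ℝ I).comp q = (Ideal.Quotient.mkₐ ℝ I).comp p.1.val := by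
    refine algHom_ext (ker_quotResidue_pow hI hN) F _ _ ?_ hqχ fun i => ?_
    · rw [← AlgHom.comp_assoc, ← AlgHom.comp_assoc, quotResidue_comp, hq]
    · refine Ideal.Quotient.eq.2 ?_
      change q (F.x i) - p.1.val (F.x i) ∈ I
      rw [hqx, sub_sub_cancel_left, Algebra.smul_def]
      exact I.neg_mem (I.mul_mem_left _ hv)
  have hs := (regTrans I p).2
  change Function.Surjective ((Ideal.Quotient.mkₐ ℝ I).comp p.1.val) at hs
  rwa [← hpq] at hs

end NearPoints

theorem theorem7 (n : ℕ) (M : Type*) [TopologicalSpace M]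
    [ChartedSpace (EuclideanSpace ℝ (Fin n)) M] [IsManifold (𝓡 n) ∞ M]
    [T2Space M] [SecondCountableTopology M]
    (A : Type*) [CommRing A] [Algebra ℝ A] [Module.Finite ℝ A] [IsLocalRing A]
    (I : Ideal A) (hI : I ≠ ⊤) (hM : Nonempty (RegPoint n M A)) :
    (IsCanonicalAffineBundle n M I ↔
      I ≤ IsLocalRing.maximalIdeal A ^ 2 ⊓ Submodule.annihilator I) ∧
    (I ≤ IsLocalRing.maximalIdeal A ^ 2 ↔
      ∀ p : NearPoint n M A, (natTrans I p).IsRegular → p.IsRegular) := by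
  obtain ⟨p⟩ := hM
  obtain ⟨ρ⟩ := WeilAlgebra.exists_algHom_real p.1.val p.2 SmoothFun.isUnit_sq_add_one
  obtain ⟨N, hN⟩ := WeilAlgebra.exists_ker_pow_eq_bot ρ
  have hI' : I ≤ RingHom.ker ρ := by
    rw [WeilAlgebra.ker_eq_maximalIdeal]
    exact IsLocalRing.le_maximalIdeal hI
  have hann : I ≤ Submodule.annihilator I ↔ ∀ a ∈ I, ∀ b ∈ I, a * b = 0 :=
    ⟨fun h a ha => Submodule.mem_annihilator.1 (h ha),
      fun h a ha => Submodule.mem_annihilator.2 (h a ha)⟩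
  rw [← WeilAlgebra.ker_eq_maximalIdeal ρ, le_inf_iff, hann]
  refine ⟨⟨fun h => ?_, fun h => isCanonicalAffineBundle hN h.1 h.2⟩,
    fun h q hq => WeilAlgebra.surjective_of_surjective_mod hN h q.val hq,
    fun h => ideal_le_sq_of_isRegular hN hI' p h⟩
  -- Necessity uses only that translates of one regular point are regular points.
  have hadd : ∀ D ∈ vertDer I p.1, ∃ q : RegPoint n M A, ∀ f, q.1.val f = p.1.val f + D f :=
    fun D hD => (h.add_mem p D hD).imp fun _ hq => hq.2
  exact ⟨ideal_le_sq_of_add_mem hN hI' p hadd, mul_eq_zero_of_add_mem hN hI' p hadd⟩
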